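/- Let $0<q<1$. Write $(x;p)_n=\prod_{j=0}^{n-1}(1-xp^j)$, $(x;p)_\infty=\prod_{j\ge 0}(1-xp^j)$, $(x,y;p)_n=(x;p)_n(y;p)_n$, $(x)_n=x(x+1)\cdots(x+n-1)$ and $\Gamma_q(x)=\frac{(q;q)_\infty}{(q^x;q)_\infty}(1-q)^{1-x}$. Let $b,c\in\mathbb{C}$ be such that $q^{2b+2+2m}\neq 1$ and $q^{2c+2+2m}\ne 1$ for all integers $m\ge 0$ (this holds in particular for all $b,c$ in a neighbourhood of $0$). (1) For every $a\in\mathbb{C}$ with $\Re(a)>0$, both series below converge absolutely and $$(1-q^{2a})\sum_{k\geq 0} \frac{q^{2 a k} (q^{-a+b+c+\frac{1}{2}};q)_{2 k}}{(q^{2 b+2};q^2)_k (q^{2 c+2};q^2)_k} = -\sum_{n\geq 0} \frac{(-1)^{n} q^{3 a n+b n+c n+7 n^2/2-3/2}\, P_q(n)\, (q^{a+b-c+\frac{1}{2}},q^{a-b+c+\frac{1}{2}};q)_n (q^{-a+b+c+\frac{1}{2}};q)_{3 n}}{(1-q^{b+2 n+1})(1+q^{b+2 n+1})(1-q^{c+2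 n+1})(1+q^{c+2 n+1})(q^{2 a+2};q^2)_n (q^{2 b+2},q^{2 c+2};q^2)_{2 n}},$$ where $P_q(n) = q^{a+b+c+5 n+2}+q^{a+b+c+5 n+3}+q^{3 a+b+c+7 n+4}-q^{2 a+2 b+2 c+10 n+9/2}+q^{a+3 b+3 c+13 n+6}-q^{2 a+2 b+6 n+7/2}-q^{2 a+2 c+6 n+7/2}-q^{2 b+2 c+8 n+7/2}-q^{2 b+2 c+8 n+11/2}+q^{2 b+4 n+7/2}+q^{2 c+4 n+7/2}-q^{3/2}$. (2) The following two-parameter identity holds, the series converging absolutely: $$\sum_{n\geq 0}\frac{(-1)^n q^{b n+c n+7n^2/2-3/2}\, \tilde{P}_q(n)\,(q^{b-c+\frac{1}{2}},q^{-b+c+\frac{1}{2}};q)_n (q^{b+c+\frac{1}{2}};q)_{3 n}}{(1-q^{b+2 n+1}) (1+q^{b+2 n+1}) (1-q^{c+2 n+1}) (1+q^{c+2 n+1}) (q^2;q^2)_n(q^{2b+2},q^{2c+2};q^2)_{2n}} = \frac{(1-q) (1+q)^{b+c+\frac{1}{2}} \Gamma _{q^2}(b+1) \Gamma _{q^2}(c+1)}{\Gamma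 _{q^2}\left(\frac{1}{2}\right) \Gamma _q\left(b+c+\frac{1}{2}\right)},$$ where $1/\Gamma_q$ is understood as an entire function and $\tilde{P}_q(n) = -q^{b+c+5 n+2}-q^{b+c+5 n+3}-q^{b+c+7 n+4}+q^{2 b+2 c+8 n+7/2}+q^{2 b+2 c+8 n+11/2}+q^{2 b+2 c+10 n+9/2}-q^{3 b+3 c+13 n+6}-q^{2 b+4 n+7/2}+q^{2 b+6 n+7/2}-q^{2 c+4 n+7/2}+q^{2 c+6 n+7/2}+q^{3/2}$. (3) Setting $b=c=0$ and replacing $q$ by $q^2$, the identity in (2) becomes, summand by summand and on the right-hand side, $$\sum_{n\geq 0} \frac{(-1)^{n} q^{7 n^2}\, R_q(n)\, (q;q^2)_{3 n} (q;q^2)_n^2}{(1+q^{2 n+1})^2 (1+q^{4 n+2})^2 (q^4;q^4)_n (q^4;q^4)_{2 n}^2} = \frac{\left(1-q^2\right) \sqrt{1+q^2}}{\Gamma _{q^2}\left(\frac{1}{2}\right) \Gamma _{q^4}\left(\frac{1}{2}\right)},$$ which therefore holds, the series converging absolutely, where $R_q(n)=2 q^{2 n+1}+3 q^{4 n+2}+4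 q^{6 n+3}+3 q^{8 n+4}-q^{10 n+1}-q^{10 n+3}+2 q^{10 n+5}-2 q^{12 n+2}+q^{12 n+6}-3 q^{14 n+3}-3 q^{16 n+4}-3 q^{18 n+5}-2 q^{20 n+6}-q^{22 n+7}+1$. (4) The identity in (3) is a $q$-analogue of $$\sum_{n\geq 0} \left(-\frac{3^3}{2^9}\right)^n \frac{(\frac{1}{2})_n (\frac{1}{6})_n (\frac{5}{6})_n}{(1)_n^3} (154n+15) = \frac{32\sqrt{2}}{\pi}$$ in the following sense: this last identity holds (with absolute convergence), and after division by $1-q^2$ and as $q\to1^-$, for each $n$ the $n$-th summand on the left of (3) tends to $\frac1{32}$ times the $n$-th summand of this series, while the right-hand side of (3) tends to $\frac{\sqrt2}{\pi}$. -/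

import Mathlib

open Filter Topology

noncomputable section

/-- The finite `q`-shifted factorial `(a; q)_n = ∏_{0 ≤ j < n} (1 - a q^j)`. -/
def qPoch (a q : ℂ) (n : ℕ) : ℂ := ∏ j ∈ Finset.range n, (1 - a * q ^ j)

/-- The infinite `q`-shifted factorial `(a; q)_∞ = ∏_{j ≥ 0} (1 - a q^j)`, for `|q| < 1`. -/
def qPochInf (a q : ℂ) : ℂ := ∏' j : ℕ, (1 - a * q ^ j)

/-- The `q`-gamma function `Γ_q(x) = (q; q)_∞ / (q^x; q)_∞ * (1 - q)^(1 - x)`, for `0 < q < 1`. At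
its poles the value here is `0`, so that `1 / Γ_q`, an entire function, has its true value `0`. -/
def qGamma (q : ℝ) (x : ℂ) : ℂ :=
  qPochInf (q : ℂ) (q : ℂ) / qPochInf ((q : ℂ) ^ x) (q : ℂ) * ((1 - q : ℝ) : ℂ) ^ (1 - x)

/-- The `k`-th summand of the series on the left of the three-parameter identity. -/
def seriesA (q : ℝ) (a b c : ℂ) (k : ℕ) : ℂ :=
  (q : ℂ) ^ (2 * a * k) * qPoch ((q : ℂ) ^ (-a + b + c + 1 / 2)) q (2 * k) /
    (qPoch ((q : ℂ) ^ (2 * b + 2)) ((q : ℂ) ^ 2) k * qPoch ((q : ℂ) ^ (2 * c + 2)) ((q : ℂ) ^ 2) k)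

/-- The factor `P_q(n)` of the three-parameter identity. -/
def polyP (q : ℝ) (a b c : ℂ) (n : ℕ) : ℂ :=
  (q : ℂ) ^ (a + b + c + 5 * n + 2) + (q : ℂ) ^ (a + b + c + 5 * n + 3)
    + (q : ℂ) ^ (3 * a + b + c + 7 * n + 4) - (q : ℂ) ^ (2 * a + 2 * b + 2 * c + 10 * n + 9 / 2)
    + (q : ℂ) ^ (a + 3 * b + 3 * c + 13 * n + 6) - (q : ℂ) ^ (2 * a + 2 * b + 6 * n + 7 / 2)
    - (q : ℂ) ^ (2 * a + 2 * c + 6 * n + 7 / 2) - (q : ℂ) ^ (2 * b + 2 * c + 8 * n + 7 / 2)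
    - (q : ℂ) ^ (2 * b + 2 * c + 8 * n + 11 / 2) + (q : ℂ) ^ (2 * b + 4 * n + 7 / 2)
    + (q : ℂ) ^ (2 * c + 4 * n + 7 / 2) - (q : ℂ) ^ (3 / 2 : ℂ)

/-- The `n`-th summand of the series on the right of the three-parameter identity. -/
def seriesB (q : ℝ) (a b c : ℂ) (n : ℕ) : ℂ :=
  (-1) ^ n * (q : ℂ) ^ (3 * a * n + b * n + c * n + 7 * n ^ 2 / 2 - 3 / 2) * polyP q a b c n *
      (qPoch ((q : ℂ) ^ (a + b - c + 1 / 2)) q n * qPoch ((q : ℂ) ^ (a - b + c + 1 / 2)) q n) *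
      qPoch ((q : ℂ) ^ (-a + b + c + 1 / 2)) q (3 * n) /
    ((1 - (q : ℂ) ^ (b + 2 * n + 1)) * ((q : ℂ) ^ (b + 2 * n + 1) + 1) *
      (1 - (q : ℂ) ^ (c + 2 * n + 1)) * ((q : ℂ) ^ (c + 2 * n + 1) + 1) *
      qPoch ((q : ℂ) ^ (2 * a + 2)) ((q : ℂ) ^ 2) n *
      (qPoch ((q : ℂ) ^ (2 * b + 2)) ((q : ℂ) ^ 2) (2 * n) *
        qPoch ((q : ℂ) ^ (2 * c + 2)) ((q : ℂ) ^ 2) (2 * n)))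

/-- The factor `P̃_q(n)` of the two-parameter identity. -/
def polyPt (q : ℝ) (b c : ℂ) (n : ℕ) : ℂ :=
  -(q : ℂ) ^ (b + c + 5 * n + 2) - (q : ℂ) ^ (b + c + 5 * n + 3)
    - (q : ℂ) ^ (b + c + 7 * n + 4) + (q : ℂ) ^ (2 * b + 2 * c + 8 * n + 7 / 2)
    + (q : ℂ) ^ (2 * b + 2 * c + 8 * n + 11 / 2) + (q : ℂ) ^ (2 * b + 2 * c + 10 * n + 9 / 2)
    - (q : ℂ) ^ (3 * b + 3 * c + 13 * n + 6) - (q : ℂ) ^ (2 * b + 4 * n + 7 / 2)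
    + (q : ℂ) ^ (2 * b + 6 * n + 7 / 2) - (q : ℂ) ^ (2 * c + 4 * n + 7 / 2)
    + (q : ℂ) ^ (2 * c + 6 * n + 7 / 2) + (q : ℂ) ^ (3 / 2 : ℂ)

/-- The `n`-th summand of the two-parameter identity. -/
def seriesC (q : ℝ) (b c : ℂ) (n : ℕ) : ℂ :=
  (-1) ^ n * (q : ℂ) ^ (b * n + c * n + 7 * n ^ 2 / 2 - 3 / 2) * polyPt q b c n *
      (qPoch ((q : ℂ) ^ (b - c + 1 / 2)) q n * qPoch ((q : ℂ) ^ (-b + c + 1 / 2)) q n) *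
      qPoch ((q : ℂ) ^ (b + c + 1 / 2)) q (3 * n) /
    ((1 - (q : ℂ) ^ (b + 2 * n + 1)) * ((q : ℂ) ^ (b + 2 * n + 1) + 1) *
      (1 - (q : ℂ) ^ (c + 2 * n + 1)) * ((q : ℂ) ^ (c + 2 * n + 1) + 1) *
      qPoch ((q : ℂ) ^ 2) ((q : ℂ) ^ 2) n *
      (qPoch ((q : ℂ) ^ (2 * b + 2)) ((q : ℂ) ^ 2) (2 * n) *
        qPoch ((q : ℂ) ^ (2 * c + 2)) ((q : ℂ) ^ 2) (2 * n)))

/-- The right-hand side of the two-parameter identity. -/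
def valueC (q : ℝ) (b c : ℂ) : ℂ :=
  (1 - (q : ℂ)) * (1 + (q : ℂ)) ^ (b + c + 1 / 2) * qGamma (q ^ 2) (b + 1) * qGamma (q ^ 2) (c + 1) /
    (qGamma (q ^ 2) (1 / 2) * qGamma q (b + c + 1 / 2))

/-- The `n`-th summand of the one-variable `q`-identity (parameters zero, base `q ^ 2`). -/
def seriesD (q : ℝ) (n : ℕ) : ℂ :=
  (-1) ^ n * (q : ℂ) ^ (7 * n ^ 2) *
      (2 * (q : ℂ) ^ (2 * n + 1) + 3 * (q : ℂ) ^ (4 * n + 2) + 4 * (q : ℂ) ^ (6 * n + 3)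
        + 3 * (q : ℂ) ^ (8 * n + 4) - (q : ℂ) ^ (10 * n + 1) - (q : ℂ) ^ (10 * n + 3)
        + 2 * (q : ℂ) ^ (10 * n + 5) - 2 * (q : ℂ) ^ (12 * n + 2) + (q : ℂ) ^ (12 * n + 6)
        - 3 * (q : ℂ) ^ (14 * n + 3) - 3 * (q : ℂ) ^ (16 * n + 4) - 3 * (q : ℂ) ^ (18 * n + 5)
        - 2 * (q : ℂ) ^ (20 * n + 6) - (q : ℂ) ^ (22 * n + 7) + 1) *
      qPoch q ((q : ℂ) ^ 2) (3 * n) * qPoch q ((q : ℂ) ^ 2) n ^ 2 /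
    (((q : ℂ) ^ (2 * n + 1) + 1) ^ 2 * ((q : ℂ) ^ (4 * n + 2) + 1) ^ 2 *
      qPoch ((q : ℂ) ^ 4) ((q : ℂ) ^ 4) n * qPoch ((q : ℂ) ^ 4) ((q : ℂ) ^ 4) (2 * n) ^ 2)

/-- The right-hand side of the one-variable `q`-identity. -/
def valueD (q : ℝ) : ℂ :=
  (1 - (q : ℂ) ^ 2) * (Real.sqrt (1 + q ^ 2) : ℂ) /
    (qGamma (q ^ 2) (1 / 2) * qGamma (q ^ 4) (1 / 2))

/-- The rising factorial `(x)_n = x (x + 1) ⋯ (x + n - 1)`. -/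
def rising (x : ℝ) (n : ℕ) : ℝ := (ascPochhammer ℝ n).eval x

/-- The `n`-th summand `(-3³/2⁹)ⁿ (1/2)_n (1/6)_n (5/6)_n / (1)_n³ (154 n + 15)`. -/
def seriesE (n : ℕ) : ℝ :=
  (-(3 ^ 3 / 2 ^ 9)) ^ n * (rising (1 / 2) n * rising (1 / 6) n * rising (5 / 6) n / rising 1 n ^ 3) *
    (154 * n + 15)

end

/-! Put `A = q^a`, `B = q^b`, `C = q^c`, `s = q^(1/2)`; all summands become rational in these and in
powers of `q`. Write φ_k for `phiTerm`, ρ for `recCoeff` and G_k for `certTerm`. The core is a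
WZ-type telescoping (`certTerm_succ_sub`): (1 - A²) φ_k(A,B,C) - ρ (1 - A²q²) φ_k(Aq,Bq²,Cq²) =
G_(k+1) - G_k, which after division by φ_k is a polynomial identity (`certificate_identity`).

Summing over k uses two boundary values: G_0 is the initial term of the accelerated series, and G_k
tends to -lim φ_k. For |A| < 1 this limit is 0, which gives a recurrence for (1 - A²) Σ φ_k under
(A,B,C) → (Aq,Bq²,Cq²). Iterating it produces the accelerated series, since `accTerm` is a product
of shifted values of ρ times a shifted initial term. The remainder vanishes because ρ tends to 0
along the shifts while the shifted sums stay bounded (`tsum_phiTerm_eq`). This is (1).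

For (2) no limit a → 0 is taken. At A = 1 the factor 1 - A² removes the divergent series, and lim
φ_k is a quotient of infinite products. One telescoping step leads to A = q, where (1) applies
(`hasSum_accTerm_one`). The quotient is the stated q-gamma expression (`valueC_eq`), and (3) is the
case b = c = 0 in base q².

For (4), divide (3) by 1 - q² and let q → 1⁻. The summands have a geometric bound uniform in q
(`norm_seriesD_div_le`), so dominated convergence applies on the left. On the right one needs
Γ_(q²)(1/2) → √π, obtained from a q-analogue of Wallis' product (`tendsto_qGamma_half_re`).
Uniqueness of limits then evaluates the classical series. -/

/-! ### Finite and infinite q-shifted factorials: convergence and bounds. -/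

theorem qPoch_zero (a q : ℂ) : qPoch a q 0 = 1 := by simp [qPoch]

theorem qPoch_succ (a q : ℂ) (n : ℕ) : qPoch a q (n + 1) = qPoch a q n * (1 - a * q ^ n) := by
  simp [qPoch, Finset.prod_range_succ]

theorem qPoch_add (a q : ℂ) (m n : ℕ) :
    qPoch a q (m + n) = qPoch a q m * qPoch (a * q ^ m) q n := by
  simp only [qPoch, Finset.prod_range_add, pow_add, mul_assoc]

theorem qPoch_two (a q : ℂ) : qPoch a q 2 = (1 - a) * (1 - a * q) := by
  simp [qPoch, Finset.prod_range_succ]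

theorem qPoch_three (a q : ℂ) : qPoch a q 3 = (1 - a) * (1 - a * q) * (1 - a * q ^ 2) := by
  simp [qPoch, Finset.prod_range_succ]

theorem qPoch_ne_zero {a q : ℂ} (h : ∀ j : ℕ, a * q ^ j ≠ 1) (n : ℕ) : qPoch a q n ≠ 0 :=
  Finset.prod_ne_zero_iff.2 fun j _ => sub_ne_zero.2 (h j).symm

theorem summable_norm_mul_pow (a : ℂ) {q : ℂ} (hq : ‖q‖ < 1) :
    Summable fun j : ℕ => ‖-(a * q ^ j)‖ := by
  simpa using (summable_geometric_of_lt_one (norm_nonneg q) hq).mul_left ‖a‖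

theorem tendsto_qPoch (a : ℂ) {q : ℂ} (hq : ‖q‖ < 1) :
    Tendsto (qPoch a q) atTop (𝓝 (qPochInf a q)) := by
  have h := (multipliable_one_add_of_summable
    (summable_norm_mul_pow a hq)).hasProd.tendsto_prod_nat
  simp only [← sub_eq_add_neg] at h
  exact h

theorem qPochInf_ne_zero {a q : ℂ} (hq : ‖q‖ < 1) (h : ∀ j : ℕ, a * q ^ j ≠ 1) :
    qPochInf a q ≠ 0 := by
  have := tprod_one_add_ne_zero_of_summable (f := fun j : ℕ => -(a * q ^ j))
    (fun j => by rw [← sub_eq_add_neg]; exact sub_ne_zero.2 (h j).symm)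
    (summable_norm_mul_pow a hq)
  simp only [← sub_eq_add_neg] at this
  exact this

theorem norm_qPoch_le (a : ℂ) {q : ℂ} (hq : ‖q‖ < 1) (n : ℕ) :
    ‖qPoch a q n‖ ≤ Real.exp (‖a‖ * (1 - ‖q‖)⁻¹) := by
  rw [qPoch, norm_prod]
  calc ∏ j ∈ Finset.range n, ‖1 - a * q ^ j‖
      ≤ ∏ j ∈ Finset.range n, Real.exp (‖a‖ * ‖q‖ ^ j) := by
        refine Finset.prod_le_prod (fun _ _ => norm_nonneg _) fun j _ => ?_
        have h1 : ‖1 - a * q ^ j‖ ≤ 1 + ‖a‖ * ‖q‖ ^ j := by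
          simpa using norm_sub_le (1 : ℂ) (a * q ^ j)
        linarith [Real.add_one_le_exp (‖a‖ * ‖q‖ ^ j)]
    _ = Real.exp (‖a‖ * ∑ j ∈ Finset.range n, ‖q‖ ^ j) := by
        rw [← Real.exp_sum, Finset.mul_sum]
    _ ≤ _ := by
        gcongr
        rw [← tsum_geometric_of_lt_one (norm_nonneg q) hq]
        exact (summable_geometric_of_lt_one (norm_nonneg q) hq).sum_le_tsum _
          fun _ _ => by positivity

/-- The shifted factorial is (a;q)_(m+n) / (a;q)_m. The numerators are nonzero with a nonzero limit,
so they stay away from 0, and the denominators are bounded. Uniformity in m is what allows all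
iterated shifts to be bounded at once. -/
theorem exists_le_norm_qPoch {a q : ℂ} (hq : ‖q‖ < 1) (h : ∀ j : ℕ, a * q ^ j ≠ 1) :
    ∃ δ > 0, ∀ m n : ℕ, δ ≤ ‖qPoch (a * q ^ m) q n‖ := by
  have h1 : Tendsto (fun n => ‖qPoch a q n‖⁻¹) atTop (𝓝 ‖qPochInf a q‖⁻¹) :=
    (tendsto_qPoch a hq).norm.inv₀ (norm_ne_zero_iff.2 (qPochInf_ne_zero hq h))
  obtain ⟨M, hM⟩ := h1.bddAbove_range
  have hM' : ∀ n, ‖qPoch a q n‖⁻¹ ≤ M := fun n => hM ⟨n, rfl⟩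
  have hpos : ∀ n, 0 < ‖qPoch a q n‖ := fun n => norm_pos_iff.2 (qPoch_ne_zero h n)
  have hM0 : 0 < M := (inv_pos.2 (hpos 0)).trans_le (hM' 0)
  refine ⟨M⁻¹ * (Real.exp (‖a‖ * (1 - ‖q‖)⁻¹))⁻¹, by positivity, fun m n => ?_⟩
  have h2 : ‖qPoch a q (m + n)‖ = ‖qPoch a q m‖ * ‖qPoch (a * q ^ m) q n‖ := by
    rw [qPoch_add, norm_mul]
  have h3 : M⁻¹ ≤ ‖qPoch a q (m + n)‖ := inv_le_of_inv_le₀ (hpos _) (hM' _)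
  rw [← div_eq_mul_inv, div_le_iff₀ (by positivity)]
  calc M⁻¹ ≤ _ := h3
    _ = ‖qPoch (a * q ^ m) q n‖ * ‖qPoch a q m‖ := by rw [h2, mul_comm]
    _ ≤ _ := by gcongr; exact norm_qPoch_le a hq m

/-! ### The rational form of the summands and the WZ data. -/

noncomputable section

/-- The summand of the `₃φ₂`-type series with `A = q ^ a`, `B = q ^ b`, `C = q ^ c`, `s ^ 2 = q`. -/
def phiTerm (q s A B C : ℂ) (k : ℕ) : ℂ :=
  A ^ (2 * k) * qPoch (B * C * s / A) q (2 * k) /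
    (qPoch (B ^ 2 * q ^ 2) (q ^ 2) k * qPoch (C ^ 2 * q ^ 2) (q ^ 2) k)

/-- The polynomial occurring in the WZ certificate. -/
def certPoly (q s A B C v : ℂ) : ℂ :=
  A * B * C * s * (1 + q) * v + A ^ 3 * B * C * s * q ^ 2 * v - A ^ 2 * B ^ 2 * C ^ 2 * q ^ 3 * v ^ 2
    + A * B ^ 3 * C ^ 3 * s * q ^ 4 * v ^ 3 - A ^ 2 * (B ^ 2 + C ^ 2) * q ^ 2 * v
    - B ^ 2 * C ^ 2 * (q ^ 2 + q ^ 4) * v ^ 2 + (B ^ 2 + C ^ 2) * q ^ 2 * v - 1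

/-- The WZ mate of `phiTerm`. -/
def certTerm (q s A B C : ℂ) (k : ℕ) : ℂ :=
  phiTerm q s A B C k * (certPoly q s A B C ((q ^ 2) ^ k) /
    ((1 - B ^ 2 * q ^ 2 * (q ^ 2) ^ k) * (1 - C ^ 2 * q ^ 2 * (q ^ 2) ^ k)))

/-- The coefficient of the recurrence `(A, B, C) → (A q, B q², C q²)`. -/
def recCoeff (q s A B C : ℂ) : ℂ :=
  -(A ^ 3 * B * C * s * q ^ 3) * ((1 - A * B * s / C) * (1 - A * C * s / B)) *
      qPoch (B * C * s / A) q 3 /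
    ((1 - A ^ 2 * q ^ 2) *
      (qPoch (B ^ 2 * q ^ 2) (q ^ 2) 2 * qPoch (C ^ 2 * q ^ 2) (q ^ 2) 2))

/-- The summand of the accelerated series. -/
def accTerm (q s A B C : ℂ) (n : ℕ) : ℂ :=
  (-1) ^ n * ((A ^ 3 * B * C) ^ n * s ^ (7 * n ^ 2)) *
      certPoly q s (A * q ^ n) (B * (q ^ 2) ^ n) (C * (q ^ 2) ^ n) 1 *
      (qPoch (A * B * s / C) q n * qPoch (A * C * s / B) q n) *
      qPoch (B * C * s / A) q (3 * n) /
    ((1 - B ^ 2 * q ^ 2 * (q ^ 2) ^ (2 * n)) * (1 - C ^ 2 * q ^ 2 * (q ^ 2) ^ (2 * n)) *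
      qPoch (A ^ 2 * q ^ 2) (q ^ 2) n *
      (qPoch (B ^ 2 * q ^ 2) (q ^ 2) (2 * n) * qPoch (C ^ 2 * q ^ 2) (q ^ 2) (2 * n)))

end

/-! ### The telescoping identity and the shift structure of the accelerated terms. -/

section Recurrence

variable {q s A B C : ℂ}

/-- This is the telescoping relation with the common hypergeometric term divided out and
denominators cleared; v stands for q^(2k). -/
theorem certificate_identity (hs : s ^ 2 = q) (hA : A ≠ 0) (hB : B ≠ 0) (hC : C ≠ 0) (v : ℂ) :
    (1 - A ^ 2) * ((1 - B ^ 2 * q ^ 2 * v) * (1 - C ^ 2 * q ^ 2 * v)) *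
        ((1 - B ^ 2 * q ^ 4 * v) * (1 - C ^ 2 * q ^ 4 * v)) +
      A ^ 3 * B * C * s * q ^ 3 * (1 - A * B * s / C) * (1 - A * C * s / B) * v *
        ((1 - B * C * s / A * v) * (1 - B * C * s / A * q * v) * (1 - B * C * s / A * q ^ 2 * v)) =
    A ^ 2 * (1 - B * C * s / A * v) * (1 - B * C * s / A * q * v) *
        certPoly q s A B C (q ^ 2 * v) -
      ((1 - B ^ 2 * q ^ 4 * v) * (1 - C ^ 2 * q ^ 4 * v)) * certPoly q s A B C v := by
  subst hs
  simp only [certPoly]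
  field_simp
  ring

/-- The shift multiplies BCs/A by q³ and each of B²q², C²q² by q⁴. Splitting the factorials of
length 3 + 2k and 2 + k in two ways therefore expresses the shifted term through the unshifted one,
so that both can share one certificate. -/
theorem recCoeff_mul_phiTerm (hq0 : q ≠ 0) (hA : A ≠ 0)
    (hAq : 1 - A ^ 2 * q ^ 2 ≠ 0)
    (hBm : ∀ m : ℕ, B ^ 2 * q ^ 2 * (q ^ 2) ^ m ≠ 1)
    (hCm : ∀ m : ℕ, C ^ 2 * q ^ 2 * (q ^ 2) ^ m ≠ 1) (k : ℕ) :
    recCoeff q s A B C * ((1 - (A * q) ^ 2) * phiTerm q s (A * q) (B * q ^ 2) (C * q ^ 2) k) =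
      -(A ^ 3 * B * C * s * q ^ 3) * ((1 - A * B * s / C) * (1 - A * C * s / B)) * (q ^ 2) ^ k *
        qPoch (B * C * s / A * (q ^ 2) ^ k) q 3 /
        (qPoch (B ^ 2 * q ^ 2 * (q ^ 2) ^ k) (q ^ 2) 2 *
          qPoch (C ^ 2 * q ^ 2 * (q ^ 2) ^ k) (q ^ 2) 2) * phiTerm q s A B C k := by
  have e1 : B * q ^ 2 * (C * q ^ 2) * s / (A * q) = B * C * s / A * q ^ 3 := by
    field_simp
  have e2 : qPoch (B * C * s / A) q 3 * qPoch (B * C * s / A * q ^ 3) q (2 * k) =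
      qPoch (B * C * s / A) q (2 * k) * qPoch (B * C * s / A * (q ^ 2) ^ k) q 3 := by
    rw [← qPoch_add, ← pow_mul, ← qPoch_add, add_comm]
  have e3 : ∀ D : ℂ, qPoch (D ^ 2 * q ^ 2) (q ^ 2) 2 *
      qPoch ((D * q ^ 2) ^ 2 * q ^ 2) (q ^ 2) k =
      qPoch (D ^ 2 * q ^ 2) (q ^ 2) k * qPoch (D ^ 2 * q ^ 2 * (q ^ 2) ^ k) (q ^ 2) 2 := by
    intro D
    rw [show (D * q ^ 2) ^ 2 * q ^ 2 = D ^ 2 * q ^ 2 * (q ^ 2) ^ 2 by ring, ← qPoch_add,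
      ← qPoch_add, add_comm]
  have n1 := qPoch_ne_zero hBm
  have n2 := qPoch_ne_zero hCm
  have n3 : ∀ D : ℂ, (∀ m : ℕ, D ^ 2 * q ^ 2 * (q ^ 2) ^ m ≠ 1) →
      qPoch (D ^ 2 * q ^ 2 * (q ^ 2) ^ k) (q ^ 2) 2 ≠ 0 := fun D hD =>
    qPoch_ne_zero (fun j => by rw [mul_assoc, ← pow_add]; exact hD _) 2
  have n4 : ∀ D : ℂ, (∀ m : ℕ, D ^ 2 * q ^ 2 * (q ^ 2) ^ m ≠ 1) →
      qPoch ((D * q ^ 2) ^ 2 * q ^ 2) (q ^ 2) k ≠ 0 := fun D hD =>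
    qPoch_ne_zero (fun j => by
      rw [show (D * q ^ 2) ^ 2 * q ^ 2 * (q ^ 2) ^ j = D ^ 2 * q ^ 2 * (q ^ 2) ^ (j + 2) by ring]
      exact hD _) k
  have hB3 := e3 B
  have hC3 := e3 C
  have mB := n3 B hBm
  have mC := n3 C hCm
  have oB := n4 B hBm
  have oC := n4 C hCm
  have n1k := n1 k
  have n2k := n2 k
  have n12 := n1 2
  have n22 := n2 2
  rw [recCoeff, phiTerm, phiTerm, e1]
  generalize qPoch (B ^ 2 * q ^ 2 * (q ^ 2) ^ k) (q ^ 2) 2 = b1 at *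
  generalize qPoch (C ^ 2 * q ^ 2 * (q ^ 2) ^ k) (q ^ 2) 2 = c1 at *
  generalize qPoch ((B * q ^ 2) ^ 2 * q ^ 2) (q ^ 2) k = b2 at *
  generalize qPoch ((C * q ^ 2) ^ 2 * q ^ 2) (q ^ 2) k = c2 at *
  generalize qPoch (B ^ 2 * q ^ 2) (q ^ 2) k = b3 at *
  generalize qPoch (C ^ 2 * q ^ 2) (q ^ 2) k = c3 at *
  generalize qPoch (B ^ 2 * q ^ 2) (q ^ 2) 2 = b4 at *
  generalize qPoch (C ^ 2 * q ^ 2) (q ^ 2) 2 = c4 at *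
  generalize qPoch (B * C * s / A) q 3 = x1 at *
  generalize qPoch (B * C * s / A * q ^ 3) q (2 * k) = x2 at *
  generalize qPoch (B * C * s / A) q (2 * k) = x3 at *
  generalize qPoch (B * C * s / A * (q ^ 2) ^ k) q 3 = x4 at *
  generalize (1 - A * B * s / C) * (1 - A * C * s / B) = u
  rw [show (A * q) ^ (2 * k) = A ^ (2 * k) * (q ^ 2) ^ k by rw [mul_pow, pow_mul q]]
  generalize (q ^ 2) ^ k = w
  generalize A ^ (2 * k) = z
  rw [show (A * q) ^ 2 = A ^ 2 * q ^ 2 by ring]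
  calc _ = -(A ^ 3 * B * C * s * q ^ 3) * u * w * z * (x1 * x2) / ((b4 * b2) * (c4 * c2)) := by
        field_simp
    _ = _ := by
        rw [e2, hB3, hC3]
        field_simp

theorem phiTerm_succ (k : ℕ) :
    phiTerm q s A B C (k + 1) = phiTerm q s A B C k *
      (A ^ 2 * ((1 - B * C * s / A * (q ^ 2) ^ k) * (1 - B * C * s / A * q * (q ^ 2) ^ k)) /
        ((1 - B ^ 2 * q ^ 2 * (q ^ 2) ^ k) * (1 - C ^ 2 * q ^ 2 * (q ^ 2) ^ k))) := by
  rw [phiTerm, phiTerm, qPoch_succ, qPoch_succ, show 2 * (k + 1) = 2 * k + 1 + 1 by ring,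
    qPoch_succ, qPoch_succ, pow_succ q, pow_mul q, div_mul_div_comm]
  congr 1 <;> ring

theorem certTerm_succ_sub (hs : s ^ 2 = q) (hq0 : q ≠ 0) (hA : A ≠ 0) (hB : B ≠ 0) (hC : C ≠ 0)
    (hAq : 1 - A ^ 2 * q ^ 2 ≠ 0)
    (hBm : ∀ m : ℕ, B ^ 2 * q ^ 2 * (q ^ 2) ^ m ≠ 1)
    (hCm : ∀ m : ℕ, C ^ 2 * q ^ 2 * (q ^ 2) ^ m ≠ 1) (k : ℕ) :
    (1 - A ^ 2) * phiTerm q s A B C k -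
      recCoeff q s A B C * ((1 - (A * q) ^ 2) * phiTerm q s (A * q) (B * q ^ 2) (C * q ^ 2) k) =
    certTerm q s A B C (k + 1) - certTerm q s A B C k := by
  rw [recCoeff_mul_phiTerm hq0 hA hAq hBm hCm, certTerm, certTerm, phiTerm_succ, pow_succ' (q ^ 2) k,
    qPoch_two, qPoch_two, qPoch_three]
  have id := certificate_identity hs hA hB hC ((q ^ 2) ^ k)
  have b1 := sub_ne_zero.2 (hBm k).symm
  have c1 := sub_ne_zero.2 (hCm k).symm
  have b2 : 1 - B ^ 2 * q ^ 4 * (q ^ 2) ^ k ≠ 0 := by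
    have := sub_ne_zero.2 (hBm (k + 1)).symm
    rwa [show B ^ 2 * q ^ 2 * (q ^ 2) ^ (k + 1) = B ^ 2 * q ^ 4 * (q ^ 2) ^ k by ring] at this
  have c2 : 1 - C ^ 2 * q ^ 4 * (q ^ 2) ^ k ≠ 0 := by
    have := sub_ne_zero.2 (hCm (k + 1)).symm
    rwa [show C ^ 2 * q ^ 2 * (q ^ 2) ^ (k + 1) = C ^ 2 * q ^ 4 * (q ^ 2) ^ k by ring] at this
  generalize (q ^ 2) ^ k = v at *
  rw [show B ^ 2 * q ^ 2 * (q ^ 2 * v) = B ^ 2 * q ^ 4 * v by ring,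
    show C ^ 2 * q ^ 2 * (q ^ 2 * v) = C ^ 2 * q ^ 4 * v by ring,
    show B ^ 2 * q ^ 2 * v * q ^ 2 = B ^ 2 * q ^ 4 * v by ring,
    show C ^ 2 * q ^ 2 * v * q ^ 2 = C ^ 2 * q ^ 4 * v by ring,
    show B * C * s / A * v * q ^ 2 = B * C * s / A * q ^ 2 * v by ring,
    show B * C * s / A * v * q = B * C * s / A * q * v by ring]
  generalize phiTerm q s A B C k = t
  generalize certPoly q s A B C (q ^ 2 * v) = N1 at *
  generalize certPoly q s A B C v = N0 at *
  generalize 1 - B ^ 2 * q ^ 2 * v = β1 at *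
  generalize 1 - C ^ 2 * q ^ 2 * v = γ1 at *
  generalize 1 - B ^ 2 * q ^ 4 * v = β2 at *
  generalize 1 - C ^ 2 * q ^ 4 * v = γ2 at *
  generalize 1 - B * C * s / A * v = x0 at *
  generalize 1 - B * C * s / A * q * v = x1 at *
  generalize 1 - B * C * s / A * q ^ 2 * v = x2 at *
  generalize 1 - A * B * s / C = y1 at *
  generalize 1 - A * C * s / B = y2 at *
  field_simp
  linear_combination t * id

theorem accTerm_succ (hs : s ^ 2 = q) (hq0 : q ≠ 0) (hA : A ≠ 0) (hB : B ≠ 0) (hC : C ≠ 0)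
    (n : ℕ) :
    accTerm q s A B C (n + 1) =
      recCoeff q s A B C * accTerm q s (A * q) (B * q ^ 2) (C * q ^ 2) n := by
  rw [accTerm, accTerm, recCoeff]
  rw [show B * q ^ 2 * (C * q ^ 2) * s / (A * q) = B * C * s / A * q ^ 3 by field_simp,
    show A * q * (B * q ^ 2) * s / (C * q ^ 2) = A * B * s / C * q ^ 1 by field_simp,
    show A * q * (C * q ^ 2) * s / (B * q ^ 2) = A * C * s / B * q ^ 1 by field_simp,
    show 3 * (n + 1) = 3 + 3 * n by ring, show 2 * (n + 1) = 2 + 2 * n by ring, add_comm n 1,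
    qPoch_add _ _ 3, qPoch_add _ _ 1 n, qPoch_add _ _ 1 n, qPoch_add _ _ 1 n, qPoch_add _ _ 2,
    qPoch_add _ _ 2, show (B * q ^ 2) ^ 2 * q ^ 2 = B ^ 2 * q ^ 2 * (q ^ 2) ^ 2 by ring,
    show (C * q ^ 2) ^ 2 * q ^ 2 = C ^ 2 * q ^ 2 * (q ^ 2) ^ 2 by ring,
    show (A * q) ^ 2 * q ^ 2 = A ^ 2 * q ^ 2 * (q ^ 2) ^ 1 by ring,
    show A * q ^ (1 + n) = A * q * q ^ n by ring,
    show B * (q ^ 2) ^ (1 + n) = B * q ^ 2 * (q ^ 2) ^ n by ring,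
    show C * (q ^ 2) ^ (1 + n) = C * q ^ 2 * (q ^ 2) ^ n by ring,
    show (q ^ 2) ^ (2 + 2 * n) = (q ^ 2) ^ 2 * (q ^ 2) ^ (2 * n) by ring,
    -- The shift multiplies A³BC by q⁷ = s¹⁴. This accounts for the growth 7(n+1)² - 7n² = 14n + 7
    -- of the exponent of s, with the leftover s⁷ = s q³ supplied by `recCoeff`.
    show ((A * q) ^ 3 * (B * q ^ 2) * (C * q ^ 2)) = A ^ 3 * B * C * q ^ 7 by ring,
    show s ^ (7 * (1 + n) ^ 2) = s * (s ^ 2) ^ 3 * ((s ^ 2) ^ 7) ^ n * s ^ (7 * n ^ 2) by ring, hs]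
  have h1 : ∀ a p : ℂ, qPoch a p 1 = 1 - a := fun a p => by simp [qPoch]
  rw [h1, h1, h1, div_mul_div_comm]
  congr 1 <;> ring

end Recurrence

/-! ### Summation of the telescoping identity, iteration, and the case A = 1. -/

section Analytic

variable {q s A B C : ℂ}

theorem admissible_shift (hBm : ∀ m : ℕ, B ^ 2 * q ^ 2 * (q ^ 2) ^ m ≠ 1) (N m : ℕ) :
    (B * (q ^ 2) ^ N) ^ 2 * q ^ 2 * (q ^ 2) ^ m ≠ 1 := by
  rw [show (B * (q ^ 2) ^ N) ^ 2 * q ^ 2 * (q ^ 2) ^ m = B ^ 2 * q ^ 2 * (q ^ 2) ^ (2 * N + m) by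
    ring]
  exact hBm _

theorem norm_sq_lt_one (hq : ‖q‖ < 1) : ‖q ^ 2‖ < 1 := by
  rw [norm_pow]
  exact pow_lt_one₀ (norm_nonneg _) hq two_ne_zero

theorem one_sub_sq_ne_zero (hA : ‖A‖ < 1) : 1 - A ^ 2 ≠ 0 := by
  intro h
  have := norm_sq_lt_one hA
  rw [← sub_eq_zero.1 h, norm_one] at this
  exact lt_irrefl _ this

/-- Shifting only shrinks |A| and |BCs/A|, and it turns the denominators into tails of the same
products, so one bound serves every N. -/
theorem exists_norm_phiTerm_shift_le (hq0 : q ≠ 0) (hq : ‖q‖ < 1) (hA : A ≠ 0)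
    (hBm : ∀ m : ℕ, B ^ 2 * q ^ 2 * (q ^ 2) ^ m ≠ 1)
    (hCm : ∀ m : ℕ, C ^ 2 * q ^ 2 * (q ^ 2) ^ m ≠ 1) :
    ∃ M, ∀ N k, ‖phiTerm q s (A * q ^ N) (B * (q ^ 2) ^ N) (C * (q ^ 2) ^ N) k‖ ≤
      M * (‖A‖ ^ 2) ^ k := by
  have hq2 := norm_sq_lt_one hq
  obtain ⟨δB, hB0, hB⟩ := exists_le_norm_qPoch hq2 hBm
  obtain ⟨δC, hC0, hC⟩ := exists_le_norm_qPoch hq2 hCm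
  refine ⟨Real.exp (‖B * C * s / A‖ * (1 - ‖q‖)⁻¹) / (δB * δC), fun N k => ?_⟩
  have hX : B * (q ^ 2) ^ N * (C * (q ^ 2) ^ N) * s / (A * q ^ N) = B * C * s / A * q ^ (3 * N) := by
    field_simp
    ring
  have hD : ∀ D : ℂ, (D * (q ^ 2) ^ N) ^ 2 * q ^ 2 = D ^ 2 * q ^ 2 * (q ^ 2) ^ (2 * N) := by
    intro D; ring
  have hqN : ∀ n : ℕ, ‖q ^ n‖ ≤ 1 := fun n => by
    rw [norm_pow]; exact pow_le_one₀ (norm_nonneg _) hq.le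
  rw [phiTerm, hX, hD, hD, norm_div, norm_mul, norm_mul, norm_pow]
  have h1 : ‖A * q ^ N‖ ^ (2 * k) ≤ (‖A‖ ^ 2) ^ k := by
    rw [← pow_mul, norm_mul]
    gcongr
    exact mul_le_of_le_one_right (norm_nonneg _) (hqN N)
  have h2 : ‖qPoch (B * C * s / A * q ^ (3 * N)) q (2 * k)‖ ≤
      Real.exp (‖B * C * s / A‖ * (1 - ‖q‖)⁻¹) := by
    refine (norm_qPoch_le _ hq _).trans ?_
    have : (0 : ℝ) ≤ (1 - ‖q‖)⁻¹ := inv_nonneg.2 (by linarith)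
    gcongr
    rw [norm_mul]
    exact mul_le_of_le_one_right (norm_nonneg _) (hqN _)
  calc _ ≤ (‖A‖ ^ 2) ^ k * Real.exp (‖B * C * s / A‖ * (1 - ‖q‖)⁻¹) / (δB * δC) := by
        gcongr
        · exact hB _ _
        · exact hC _ _
    _ = _ := by ring

theorem summable_phiTerm (hq0 : q ≠ 0) (hq : ‖q‖ < 1) (hA : A ≠ 0) (hA1 : ‖A‖ < 1)
    (hBm : ∀ m : ℕ, B ^ 2 * q ^ 2 * (q ^ 2) ^ m ≠ 1)
    (hCm : ∀ m : ℕ, C ^ 2 * q ^ 2 * (q ^ 2) ^ m ≠ 1) :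
    Summable (phiTerm q s A B C) := by
  obtain ⟨M, hM⟩ := exists_norm_phiTerm_shift_le (s := s) hq0 hq hA hBm hCm
  refine Summable.of_norm_bounded (g := fun k => M * (‖A‖ ^ 2) ^ k)
    ((summable_geometric_of_lt_one (by positivity) ?_).mul_left M) fun k => by simpa using hM 0 k
  exact pow_lt_one₀ (norm_nonneg _) hA1 two_ne_zero

theorem tendsto_phiTerm_one (hq : ‖q‖ < 1)
    (hBm : ∀ m : ℕ, B ^ 2 * q ^ 2 * (q ^ 2) ^ m ≠ 1)
    (hCm : ∀ m : ℕ, C ^ 2 * q ^ 2 * (q ^ 2) ^ m ≠ 1) :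
    Tendsto (phiTerm q s 1 B C) atTop (𝓝 (qPochInf (B * C * s) q /
      (qPochInf (B ^ 2 * q ^ 2) (q ^ 2) * qPochInf (C ^ 2 * q ^ 2) (q ^ 2)))) := by
  have hq2 := norm_sq_lt_one hq
  have h1 : Tendsto (fun k : ℕ => 2 * k) atTop atTop :=
    tendsto_id.const_mul_atTop' two_pos
  have h := ((tendsto_qPoch (B * C * s) hq).comp h1).div
    ((tendsto_qPoch (B ^ 2 * q ^ 2) hq2).mul (tendsto_qPoch (C ^ 2 * q ^ 2) hq2))
    (mul_ne_zero (qPochInf_ne_zero hq2 hBm) (qPochInf_ne_zero hq2 hCm))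
  refine h.congr fun k => ?_
  simp [phiTerm]

/-- The rational factor of the certificate is continuous at v = 0, where it equals -1. -/
theorem tendsto_certTerm (hq : ‖q‖ < 1) {l : ℂ} (h : Tendsto (phiTerm q s A B C) atTop (𝓝 l)) :
    Tendsto (certTerm q s A B C) atTop (𝓝 (-l)) := by
  have hv := tendsto_pow_atTop_nhds_zero_of_norm_lt_one (norm_sq_lt_one hq)
  have hc : ContinuousAt (fun v => certPoly q s A B C v /
      ((1 - B ^ 2 * q ^ 2 * v) * (1 - C ^ 2 * q ^ 2 * v))) 0 := by
    refine ContinuousAt.div (by unfold certPoly; fun_prop) (by fun_prop) (by simp)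
  have h2 := h.mul (hc.tendsto.comp hv)
  simp only [certPoly, mul_zero, ne_eq, OfNat.ofNat_ne_zero, not_false_eq_true, zero_pow, add_zero,
    sub_zero, zero_sub, mul_one, div_one, mul_neg] at h2
  exact h2

theorem certTerm_zero : certTerm q s A B C 0 = accTerm q s A B C 0 := by
  simp [certTerm, accTerm, phiTerm, qPoch_zero]

/-- The limit l is kept general so that the same statement serves |A| < 1, where l = 0, and A = 1,
where l carries the closed form. -/
theorem tsum_cert (hs : s ^ 2 = q) (hq0 : q ≠ 0) (hq : ‖q‖ < 1) (hA : A ≠ 0) (hB : B ≠ 0)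
    (hC : C ≠ 0) (hAq : 1 - A ^ 2 * q ^ 2 ≠ 0)
    (hBm : ∀ m : ℕ, B ^ 2 * q ^ 2 * (q ^ 2) ^ m ≠ 1)
    (hCm : ∀ m : ℕ, C ^ 2 * q ^ 2 * (q ^ 2) ^ m ≠ 1) {l : ℂ}
    (hl : Tendsto (phiTerm q s A B C) atTop (𝓝 l))
    (hsum : Summable fun k => (1 - A ^ 2) * phiTerm q s A B C k - recCoeff q s A B C *
      ((1 - (A * q) ^ 2) * phiTerm q s (A * q) (B * q ^ 2) (C * q ^ 2) k)) :
    ∑' k, ((1 - A ^ 2) * phiTerm q s A B C k - recCoeff q s A B C *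
      ((1 - (A * q) ^ 2) * phiTerm q s (A * q) (B * q ^ 2) (C * q ^ 2) k)) =
      -l - accTerm q s A B C 0 := by
  refine tendsto_nhds_unique hsum.hasSum.tendsto_sum_nat ?_
  simp_rw [certTerm_succ_sub hs hq0 hA hB hC hAq hBm hCm, Finset.sum_range_sub, certTerm_zero]
  exact (tendsto_certTerm hq hl).sub_const _

theorem phi_recurrence (hs : s ^ 2 = q) (hq0 : q ≠ 0) (hq : ‖q‖ < 1) (hA : A ≠ 0) (hB : B ≠ 0)
    (hC : C ≠ 0) (hA1 : ‖A‖ < 1)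
    (hBm : ∀ m : ℕ, B ^ 2 * q ^ 2 * (q ^ 2) ^ m ≠ 1)
    (hCm : ∀ m : ℕ, C ^ 2 * q ^ 2 * (q ^ 2) ^ m ≠ 1) :
    (1 - A ^ 2) * ∑' k, phiTerm q s A B C k = -accTerm q s A B C 0 + recCoeff q s A B C *
      ((1 - (A * q) ^ 2) * ∑' k, phiTerm q s (A * q) (B * q ^ 2) (C * q ^ 2) k) := by
  have hAq : ‖A * q‖ < 1 := by
    rw [norm_mul]
    exact mul_lt_one_of_nonneg_of_lt_one_left (norm_nonneg _) hA1 hq.le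
  have h1 := summable_phiTerm (s := s) hq0 hq hA hA1 hBm hCm
  have h2 : Summable (phiTerm q s (A * q) (B * q ^ 2) (C * q ^ 2)) :=
    summable_phiTerm hq0 hq (mul_ne_zero hA hq0) hAq
      (by simpa using admissible_shift hBm 1) (by simpa using admissible_shift hCm 1)
  have h := tsum_cert hs hq0 hq hA hB hC (by rw [← mul_pow]; exact one_sub_sq_ne_zero hAq) hBm hCm
    h1.tendsto_atTop_zero ((h1.mul_left _).sub ((h2.mul_left _).mul_left _))
  rw [Summable.tsum_sub (h1.mul_left _) ((h2.mul_left _).mul_left _), tsum_mul_left, tsum_mul_left,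
    tsum_mul_left] at h
  linear_combination h

theorem accTerm_add (hs : s ^ 2 = q) (hq0 : q ≠ 0) (hA : A ≠ 0) (hB : B ≠ 0) (hC : C ≠ 0)
    (N n : ℕ) :
    accTerm q s A B C (N + n) = (∏ j ∈ Finset.range N,
        recCoeff q s (A * q ^ j) (B * (q ^ 2) ^ j) (C * (q ^ 2) ^ j)) *
      accTerm q s (A * q ^ N) (B * (q ^ 2) ^ N) (C * (q ^ 2) ^ N) n := by
  induction N generalizing n with
  | zero => simp
  | succ N ih =>
    rw [show N + 1 + n = N + (n + 1) by ring, ih, accTerm_succ hs hq0 (by positivity)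
      (by positivity) (by positivity), Finset.prod_range_succ, mul_assoc, mul_assoc, mul_assoc,
      mul_assoc, ← pow_succ, ← pow_succ]

theorem phi_iterate (hs : s ^ 2 = q) (hq0 : q ≠ 0) (hq : ‖q‖ < 1) (hA : A ≠ 0) (hB : B ≠ 0)
    (hC : C ≠ 0) (hA1 : ‖A‖ < 1)
    (hBm : ∀ m : ℕ, B ^ 2 * q ^ 2 * (q ^ 2) ^ m ≠ 1)
    (hCm : ∀ m : ℕ, C ^ 2 * q ^ 2 * (q ^ 2) ^ m ≠ 1) (N : ℕ) :
    (1 - A ^ 2) * ∑' k, phiTerm q s A B C k = -∑ n ∈ Finset.range N, accTerm q s A B C n +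
      (∏ j ∈ Finset.range N, recCoeff q s (A * q ^ j) (B * (q ^ 2) ^ j) (C * (q ^ 2) ^ j)) *
      ((1 - (A * q ^ N) ^ 2) *
        ∑' k, phiTerm q s (A * q ^ N) (B * (q ^ 2) ^ N) (C * (q ^ 2) ^ N) k) := by
  induction N with
  | zero => simp
  | succ N ih =>
    have hAN : ‖A * q ^ N‖ < 1 := by
      rw [norm_mul, norm_pow]
      exact mul_lt_one_of_nonneg_of_lt_one_left (norm_nonneg _) hA1
        (pow_le_one₀ (norm_nonneg _) hq.le)
    rw [ih, phi_recurrence hs hq0 hq (by positivity) (by positivity) (by positivity) hAN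
      (admissible_shift hBm N) (admissible_shift hCm N), Finset.sum_range_succ,
      Finset.prod_range_succ, ← add_zero N, accTerm_add hs hq0 hA hB hC]
    simp only [add_zero, mul_assoc, ← pow_succ]
    ring

/-- With x = q^j the shifted coefficient is a rational function of x, regular at 0, with a factor x⁷
coming from A³BC. -/
theorem tendsto_recCoeff_shift (hq0 : q ≠ 0) (hq : ‖q‖ < 1) (hA : A ≠ 0) (hB : B ≠ 0)
    (hC : C ≠ 0) :
    Tendsto (fun j : ℕ => recCoeff q s (A * q ^ j) (B * (q ^ 2) ^ j) (C * (q ^ 2) ^ j)) atTop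
      (𝓝 0) := by
  have hv := tendsto_pow_atTop_nhds_zero_of_norm_lt_one hq
  have hc : ContinuousAt (fun x : ℂ =>
      -(A ^ 3 * B * C * s * q ^ 3 * x ^ 7) * ((1 - A * B * s / C * x) * (1 - A * C * s / B * x)) *
      ((1 - B * C * s / A * x ^ 3) * (1 - B * C * s / A * x ^ 3 * q) *
        (1 - B * C * s / A * x ^ 3 * q ^ 2)) /
    ((1 - A ^ 2 * x ^ 2 * q ^ 2) *
      (((1 - B ^ 2 * q ^ 2 * x ^ 4) * (1 - B ^ 2 * q ^ 2 * x ^ 4 * q ^ 2)) *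
        ((1 - C ^ 2 * q ^ 2 * x ^ 4) * (1 - C ^ 2 * q ^ 2 * x ^ 4 * q ^ 2))))) 0 := by
    refine ContinuousAt.div (by fun_prop) (by fun_prop) (by simp)
  have h := hc.tendsto.comp hv
  simp only [ne_eq, OfNat.ofNat_ne_zero, not_false_eq_true, zero_pow, mul_zero, neg_zero, zero_mul,
    zero_div] at h
  refine h.congr fun j => ?_
  have e1 : A * q ^ j * (B * (q ^ 2) ^ j) * s / (C * (q ^ 2) ^ j) = A * B * s / C * q ^ j := by
    field_simp
  have e2 : A * q ^ j * (C * (q ^ 2) ^ j) * s / (B * (q ^ 2) ^ j) = A * C * s / B * q ^ j := by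
    field_simp
  have e3 : B * (q ^ 2) ^ j * (C * (q ^ 2) ^ j) * s / (A * q ^ j) = B * C * s / A * (q ^ j) ^ 3 := by
    field_simp
    ring
  rw [recCoeff, e1, e2, e3, qPoch_two, qPoch_two, qPoch_three]
  simp only [Function.comp]
  congr 1 <;> ring

theorem summable_prod_recCoeff (hq0 : q ≠ 0) (hq : ‖q‖ < 1) (hA : A ≠ 0) (hB : B ≠ 0)
    (hC : C ≠ 0) :
    Summable fun N : ℕ => ‖∏ j ∈ Finset.range N,
      recCoeff q s (A * q ^ j) (B * (q ^ 2) ^ j) (C * (q ^ 2) ^ j)‖ := by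
  refine summable_of_ratio_norm_eventually_le (r := 1 / 2) (by norm_num) ?_
  have h := (tendsto_recCoeff_shift (s := s) hq0 hq hA hB hC).norm
  rw [norm_zero] at h
  filter_upwards [h.eventually_lt_const (show (0 : ℝ) < 1 / 2 by norm_num)] with N hN
  rw [norm_norm, norm_norm, Finset.prod_range_succ, norm_mul, mul_comm]
  gcongr

/-- Again a function of x = q^N continuous at 0, so the sequence converges and is bounded. -/
theorem exists_norm_accTerm_shift_le (hq : ‖q‖ < 1) :
    ∃ M, ∀ N : ℕ, ‖accTerm q s (A * q ^ N) (B * (q ^ 2) ^ N) (C * (q ^ 2) ^ N) 0‖ ≤ M := by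
  have hv := tendsto_pow_atTop_nhds_zero_of_norm_lt_one hq
  have hc : ContinuousAt (fun x : ℂ => certPoly q s (A * x) (B * x ^ 2) (C * x ^ 2) 1 /
      ((1 - B ^ 2 * q ^ 2 * x ^ 4) * (1 - C ^ 2 * q ^ 2 * x ^ 4))) 0 := by
    refine ContinuousAt.div (by unfold certPoly; fun_prop) (by fun_prop) (by simp)
  obtain ⟨M, hM⟩ := (hc.tendsto.comp hv).norm.bddAbove_range
  refine ⟨M, fun N => le_of_eq_of_le ?_ (hM ⟨N, rfl⟩)⟩
  simp only [accTerm, Function.comp, qPoch_zero, pow_zero, mul_one, one_mul, mul_zero,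
    ne_eq, OfNat.ofNat_ne_zero, not_false_eq_true, zero_pow]
  rw [pow_right_comm q 2 N, show (B * (q ^ N) ^ 2) ^ 2 * q ^ 2 = B ^ 2 * q ^ 2 * (q ^ N) ^ 4 by ring,
    show (C * (q ^ N) ^ 2) ^ 2 * q ^ 2 = C ^ 2 * q ^ 2 * (q ^ N) ^ 4 by ring]

theorem summable_accTerm (hs : s ^ 2 = q) (hq0 : q ≠ 0) (hq : ‖q‖ < 1) (hA : A ≠ 0) (hB : B ≠ 0)
    (hC : C ≠ 0) : Summable (accTerm q s A B C) := by
  obtain ⟨M, hM⟩ := exists_norm_accTerm_shift_le (q := q) (s := s) (A := A) (B := B) (C := C) hq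
  refine Summable.of_norm_bounded ((summable_prod_recCoeff (s := s) hq0 hq hA hB hC).mul_right M)
    fun N => ?_
  have h := accTerm_add hs hq0 hA hB hC N 0
  rw [add_zero] at h
  rw [h, norm_mul]
  exact mul_le_mul_of_nonneg_left (hM N) (norm_nonneg _)

theorem tsum_phiTerm_eq (hs : s ^ 2 = q) (hq0 : q ≠ 0) (hq : ‖q‖ < 1) (hA : A ≠ 0) (hB : B ≠ 0)
    (hC : C ≠ 0) (hA1 : ‖A‖ < 1)
    (hBm : ∀ m : ℕ, B ^ 2 * q ^ 2 * (q ^ 2) ^ m ≠ 1)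
    (hCm : ∀ m : ℕ, C ^ 2 * q ^ 2 * (q ^ 2) ^ m ≠ 1) :
    (1 - A ^ 2) * ∑' k, phiTerm q s A B C k = -∑' n, accTerm q s A B C n := by
  obtain ⟨M, hM⟩ := exists_norm_phiTerm_shift_le (s := s) hq0 hq hA hBm hCm
  have hA2 : ‖A‖ ^ 2 < 1 := pow_lt_one₀ (norm_nonneg _) hA1 two_ne_zero
  have hgeom := (summable_geometric_of_lt_one (by positivity) hA2).mul_left M
  have hrem : ∀ N : ℕ, ‖(1 - (A * q ^ N) ^ 2) *
      ∑' k, phiTerm q s (A * q ^ N) (B * (q ^ 2) ^ N) (C * (q ^ 2) ^ N) k‖ ≤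
      2 * ∑' k, M * (‖A‖ ^ 2) ^ k := by
    intro N
    rw [norm_mul]
    have hAN : ‖A * q ^ N‖ ≤ 1 := by
      rw [norm_mul, norm_pow]
      exact mul_le_one₀ hA1.le (pow_nonneg (norm_nonneg q) N) (pow_le_one₀ (norm_nonneg q) hq.le)
    have h1 : ‖1 - (A * q ^ N) ^ 2‖ ≤ 2 := by
      refine (norm_sub_le _ _).trans ?_
      rw [norm_one, norm_pow]
      have := pow_le_one₀ (n := 2) (norm_nonneg (A * q ^ N)) hAN
      linarith
    have h2 := tsum_of_norm_bounded hgeom.hasSum (hM N)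
    gcongr
  -- The remainder after N iterations: a summable sequence of products times a bounded factor.
  have h0 : Tendsto (fun N : ℕ => (∏ j ∈ Finset.range N,
        recCoeff q s (A * q ^ j) (B * (q ^ 2) ^ j) (C * (q ^ 2) ^ j)) *
      ((1 - (A * q ^ N) ^ 2) *
        ∑' k, phiTerm q s (A * q ^ N) (B * (q ^ 2) ^ N) (C * (q ^ 2) ^ N) k)) atTop (𝓝 0) := by
    have hb := (summable_prod_recCoeff (s := s) hq0 hq hA hB hC).tendsto_atTop_zero.mul_const
      (2 * ∑' k, M * (‖A‖ ^ 2) ^ k)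
    rw [zero_mul] at hb
    refine squeeze_zero_norm (fun N => ?_) hb
    rw [norm_mul]
    exact mul_le_mul_of_nonneg_left (hrem N) (norm_nonneg _)
  have h3 := (summable_accTerm hs hq0 hq hA hB hC).hasSum.tendsto_sum_nat.neg.add h0
  rw [add_zero] at h3
  refine tendsto_nhds_unique (tendsto_const_nhds.congr fun N => ?_) h3
  exact phi_iterate hs hq0 hq hA hB hC hA1 hBm hCm N

/-- At A = 1 only the shifted series survives in the telescoping identity. It has A = q, so it
equals minus an accelerated series, which is the tail of the present one. -/
theorem hasSum_accTerm_one (hs : s ^ 2 = q) (hq0 : q ≠ 0) (hq : ‖q‖ < 1) (hB : B ≠ 0)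
    (hC : C ≠ 0)
    (hBm : ∀ m : ℕ, B ^ 2 * q ^ 2 * (q ^ 2) ^ m ≠ 1)
    (hCm : ∀ m : ℕ, C ^ 2 * q ^ 2 * (q ^ 2) ^ m ≠ 1) :
    HasSum (accTerm q s 1 B C) (-(qPochInf (B * C * s) q /
      (qPochInf (B ^ 2 * q ^ 2) (q ^ 2) * qPochInf (C ^ 2 * q ^ 2) (q ^ 2)))) := by
  have hq1 : ‖1 * q‖ < 1 := by rwa [one_mul]
  have hB' : ∀ m : ℕ, (B * q ^ 2) ^ 2 * q ^ 2 * (q ^ 2) ^ m ≠ 1 := by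
    simpa using admissible_shift hBm 1
  have hC' : ∀ m : ℕ, (C * q ^ 2) ^ 2 * q ^ 2 * (q ^ 2) ^ m ≠ 1 := by
    simpa using admissible_shift hCm 1
  have h2 : Summable (phiTerm q s (1 * q) (B * q ^ 2) (C * q ^ 2)) :=
    summable_phiTerm hq0 hq (by simpa using hq0) hq1 hB' hC'
  have h := tsum_cert hs hq0 hq one_ne_zero hB hC
    (by rw [one_pow, one_mul]; exact one_sub_sq_ne_zero hq) hBm hCm
    (tendsto_phiTerm_one hq hBm hCm)
    (by simpa using ((h2.mul_left (1 - (1 * q) ^ 2)).mul_left (recCoeff q s 1 B C)).neg)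
  simp only [one_pow, sub_self, zero_mul, zero_sub] at h
  rw [tsum_neg, tsum_mul_left, tsum_mul_left,
    tsum_phiTerm_eq hs hq0 hq (by simpa using hq0) (by positivity) (by positivity) hq1 hB' hC'] at h
  have hsum := summable_accTerm hs hq0 hq one_ne_zero hB hC
  rw [hsum.hasSum_iff, hsum.tsum_eq_zero_add]
  simp_rw [accTerm_succ hs hq0 one_ne_zero hB hC, tsum_mul_left]
  linear_combination h

end Analytic

/-! ### From complex powers of q to the rational form; the q-gamma closed form; base q². -/

section Translation

variable {q : ℝ}

theorem ofReal_cpow_monomial (hq : 0 < q) (a b c : ℂ) (i j k l : ℕ) :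
    (q : ℂ) ^ (i * a + j * b + k * c + l * (1 / 2)) =
      ((q : ℂ) ^ a) ^ i * ((q : ℂ) ^ b) ^ j * ((q : ℂ) ^ c) ^ k * ((q : ℂ) ^ (1 / 2 : ℂ)) ^ l := by
  have h0 : (q : ℂ) ≠ 0 := Complex.ofReal_ne_zero.2 hq.ne'
  rw [Complex.cpow_add _ _ h0, Complex.cpow_add _ _ h0, Complex.cpow_add _ _ h0,
    Complex.cpow_nat_mul, Complex.cpow_nat_mul, Complex.cpow_nat_mul, Complex.cpow_nat_mul]

theorem ofReal_cpow_half_sq (q : ℝ) : ((q : ℂ) ^ (1 / 2 : ℂ)) ^ 2 = q := by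
  rw [← Complex.cpow_nat_mul]
  norm_num

theorem ofReal_cpow_ne_zero (hq : 0 < q) (a : ℂ) : (q : ℂ) ^ a ≠ 0 := by
  rw [Complex.cpow_ne_zero_iff]
  exact Or.inl (Complex.ofReal_ne_zero.2 hq.ne')

theorem ofReal_cpow_two_mul_add_two (hq : 0 < q) (a : ℂ) :
    (q : ℂ) ^ (2 * a + 2) = ((q : ℂ) ^ a) ^ 2 * (q : ℂ) ^ 2 := by
  have h0 : (q : ℂ) ≠ 0 := Complex.ofReal_ne_zero.2 hq.ne'
  rw [Complex.cpow_add _ _ h0, Complex.cpow_ofNat_mul, Complex.cpow_ofNat]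

theorem ofReal_cpow_add_sub_add_half (hq : 0 < q) (a b c : ℂ) :
    (q : ℂ) ^ (a + b - c + 1 / 2) =
      (q : ℂ) ^ a * (q : ℂ) ^ b * (q : ℂ) ^ (1 / 2 : ℂ) / (q : ℂ) ^ c := by
  have h0 : (q : ℂ) ≠ 0 := Complex.ofReal_ne_zero.2 hq.ne'
  rw [Complex.cpow_add _ _ h0, Complex.cpow_sub _ _ h0, Complex.cpow_add _ _ h0]
  ring

theorem seriesA_eq_phiTerm (hq : 0 < q) (a b c : ℂ) (k : ℕ) :
    seriesA q a b c k = phiTerm q ((q : ℂ) ^ (1 / 2 : ℂ)) ((q : ℂ) ^ a) ((q : ℂ) ^ b)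
      ((q : ℂ) ^ c) k := by
  rw [seriesA, phiTerm, ofReal_cpow_two_mul_add_two hq, ofReal_cpow_two_mul_add_two hq,
    show -a + b + c + 1 / 2 = b + c - a + 1 / 2 by ring, ofReal_cpow_add_sub_add_half hq,
    show 2 * a * k = (2 * k : ℕ) * a by push_cast; ring, Complex.cpow_nat_mul]

/-- The extracted s³ cancels the factor q^(-3/2) in front of the summand. -/
theorem polyP_eq_certPoly (hq : 0 < q) (a b c : ℂ) (n : ℕ) :
    polyP q a b c n = ((q : ℂ) ^ (1 / 2 : ℂ)) ^ 3 * certPoly q ((q : ℂ) ^ (1 / 2 : ℂ))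
      ((q : ℂ) ^ a * (q : ℂ) ^ n) ((q : ℂ) ^ b * ((q : ℂ) ^ 2) ^ n)
      ((q : ℂ) ^ c * ((q : ℂ) ^ 2) ^ n) 1 := by
  have g := ofReal_cpow_monomial hq a b c
  -- Exponents are measured in units of 1/2, so that every monomial is an integral power of s.
  have key : ∀ (e : ℂ) (i j k l : ℕ), e = i * a + j * b + k * c + l * (1 / 2) →
      (q : ℂ) ^ e = ((q : ℂ) ^ a) ^ i * ((q : ℂ) ^ b) ^ j * ((q : ℂ) ^ c) ^ k *
        ((q : ℂ) ^ (1 / 2 : ℂ)) ^ l := fun e i j k l h => h ▸ g i j k l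
  rw [polyP, key (a + b + c + 5 * n + 2) 1 1 1 (10 * n + 4) (by push_cast; ring),
    key (a + b + c + 5 * n + 3) 1 1 1 (10 * n + 6) (by push_cast; ring),
    key (3 * a + b + c + 7 * n + 4) 3 1 1 (14 * n + 8) (by push_cast; ring),
    key (2 * a + 2 * b + 2 * c + 10 * n + 9 / 2) 2 2 2 (20 * n + 9) (by push_cast; ring),
    key (a + 3 * b + 3 * c + 13 * n + 6) 1 3 3 (26 * n + 12) (by push_cast; ring),
    key (2 * a + 2 * b + 6 * n + 7 / 2) 2 2 0 (12 * n + 7) (by push_cast; ring),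
    key (2 * a + 2 * c + 6 * n + 7 / 2) 2 0 2 (12 * n + 7) (by push_cast; ring),
    key (2 * b + 2 * c + 8 * n + 7 / 2) 0 2 2 (16 * n + 7) (by push_cast; ring),
    key (2 * b + 2 * c + 8 * n + 11 / 2) 0 2 2 (16 * n + 11) (by push_cast; ring),
    key (2 * b + 4 * n + 7 / 2) 0 2 0 (8 * n + 7) (by push_cast; ring),
    key (2 * c + 4 * n + 7 / 2) 0 0 2 (8 * n + 7) (by push_cast; ring),
    key (3 / 2) 0 0 0 3 (by push_cast; ring)]
  have hs := ofReal_cpow_half_sq q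
  generalize (q : ℂ) ^ (1 / 2 : ℂ) = s at *
  rw [← hs, certPoly]
  ring

theorem seriesB_eq_accTerm (hq : 0 < q) (a b c : ℂ) (n : ℕ) :
    seriesB q a b c n = accTerm q ((q : ℂ) ^ (1 / 2 : ℂ)) ((q : ℂ) ^ a) ((q : ℂ) ^ b)
      ((q : ℂ) ^ c) n := by
  have h0 : (q : ℂ) ≠ 0 := Complex.ofReal_ne_zero.2 hq.ne'
  have hs0 : (q : ℂ) ^ (1 / 2 : ℂ) ≠ 0 := ofReal_cpow_ne_zero hq _
  have hden : ∀ d : ℂ, (1 - (q : ℂ) ^ (d + 2 * n + 1)) * ((q : ℂ) ^ (d + 2 * n + 1) + 1) =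
      1 - ((q : ℂ) ^ d) ^ 2 * (q : ℂ) ^ 2 * ((q : ℂ) ^ 2) ^ (2 * n) := by
    intro d
    rw [show d + 2 * n + 1 = d + (2 * n + 1 : ℕ) by push_cast; ring, Complex.cpow_add _ _ h0,
      Complex.cpow_natCast]
    ring
  have hpre : (q : ℂ) ^ (3 * a * n + b * n + c * n + 7 * n ^ 2 / 2 - 3 / 2) =
      (((q : ℂ) ^ a) ^ 3 * (q : ℂ) ^ b * (q : ℂ) ^ c) ^ n *
        ((q : ℂ) ^ (1 / 2 : ℂ)) ^ (7 * n ^ 2) / ((q : ℂ) ^ (1 / 2 : ℂ)) ^ 3 := by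
    have h1 := ofReal_cpow_monomial hq a b c (3 * n) n n (7 * n ^ 2)
    rw [Complex.cpow_sub _ _ h0, show (3 / 2 : ℂ) = (3 : ℕ) * (1 / 2) by push_cast; ring,
      Complex.cpow_nat_mul _ 3, show 3 * a * n + b * n + c * n + 7 * n ^ 2 / 2 =
        (3 * n : ℕ) * a + n * b + n * c + (7 * n ^ 2 : ℕ) * (1 / 2) by push_cast; ring, h1]
    ring
  rw [seriesB, accTerm, polyP_eq_certPoly hq, hpre, mul_assoc (_ * _) (1 - _) (_ + 1), hden, hden,
    ofReal_cpow_two_mul_add_two hq, ofReal_cpow_two_mul_add_two hq, ofReal_cpow_two_mul_add_two hq,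
    show -a + b + c + 1 / 2 = b + c - a + 1 / 2 by ring, ofReal_cpow_add_sub_add_half hq,
    ofReal_cpow_add_sub_add_half hq, show a - b + c + 1 / 2 = a + c - b + 1 / 2 by ring,
    ofReal_cpow_add_sub_add_half hq]
  congr 1
  field_simp

theorem polyPt_eq (q : ℝ) (b c : ℂ) (n : ℕ) : polyPt q b c n = -polyP q 0 b c n := by
  rw [polyPt, polyP]
  ring_nf

theorem seriesC_eq_neg_accTerm (hq : 0 < q) (b c : ℂ) (n : ℕ) :
    seriesC q b c n = -accTerm q ((q : ℂ) ^ (1 / 2 : ℂ)) 1 ((q : ℂ) ^ b) ((q : ℂ) ^ c) n := by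
  have h := seriesB_eq_accTerm hq 0 b c n
  rw [Complex.cpow_zero] at h
  rw [← h, seriesC, seriesB, polyPt_eq]
  simp only [mul_zero, zero_mul, zero_add, zero_sub, neg_zero, Complex.cpow_ofNat]
  ring

/-- Odd and even powers of p are separated: (p;p)_(2k) = (p;p²)_k (p²;p²)_k, then k → ∞. -/
theorem qPochInf_self_split {p : ℂ} (hp : ‖p‖ < 1) :
    qPochInf p p = qPochInf p (p ^ 2) * qPochInf (p ^ 2) (p ^ 2) := by
  have hp2 := norm_sq_lt_one hp
  have h1 : Tendsto (fun k : ℕ => 2 * k) atTop atTop :=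
    tendsto_id.const_mul_atTop' two_pos
  refine tendsto_nhds_unique ((tendsto_qPoch p hp).comp h1)
    (((tendsto_qPoch p hp2).mul (tendsto_qPoch (p ^ 2) hp2)).congr fun k => ?_)
  induction k with
  | zero => simp [qPoch]
  | succ k ih =>
    simp only [Function.comp] at ih ⊢
    rw [qPoch_succ, qPoch_succ, show 2 * (k + 1) = 2 * k + 1 + 1 by ring, qPoch_succ, qPoch_succ,
      ← ih]
    ring

theorem norm_ofReal_lt_one (hq : 0 < q) (hq1 : q < 1) : ‖(q : ℂ)‖ < 1 := by
  rwa [Complex.norm_real, Real.norm_of_nonneg hq.le]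

theorem mul_pow_ne_one_of_norm {x y : ℂ} (hx : ‖x‖ < 1) (hy : ‖y‖ < 1) (j : ℕ) :
    x * y ^ j ≠ 1 := by
  intro h
  have := congrArg norm h
  rw [norm_mul, norm_pow, norm_one] at this
  exact (mul_lt_one_of_nonneg_of_lt_one_left (norm_nonneg _) hx
    (pow_le_one₀ (norm_nonneg _) hy.le)).ne this

theorem ofReal_sq_cpow (hq : 0 < q) (x : ℂ) :
    ((q ^ 2 : ℝ) : ℂ) ^ x = (q : ℂ) ^ (2 * x) := by
  rw [sq, Complex.ofReal_mul, Complex.mul_cpow_ofReal_nonneg hq.le hq.le, two_mul,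
    Complex.cpow_add _ _ (Complex.ofReal_ne_zero.2 hq.ne')]

theorem valueC_eq (hq : 0 < q) (hq1 : q < 1) (b c : ℂ) :
    valueC q b c = qPochInf ((q : ℂ) ^ b * (q : ℂ) ^ c * (q : ℂ) ^ (1 / 2 : ℂ)) q /
      (qPochInf (((q : ℂ) ^ b) ^ 2 * (q : ℂ) ^ 2) ((q : ℂ) ^ 2) *
        qPochInf (((q : ℂ) ^ c) ^ 2 * (q : ℂ) ^ 2) ((q : ℂ) ^ 2)) := by
  have h0 : (q : ℂ) ≠ 0 := Complex.ofReal_ne_zero.2 hq.ne'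
  have hn := norm_ofReal_lt_one hq hq1
  have hn2 := norm_sq_lt_one hn
  have n1 : qPochInf (q : ℂ) ((q : ℂ) ^ 2) ≠ 0 :=
    qPochInf_ne_zero hn2 (mul_pow_ne_one_of_norm hn hn2)
  have n2 : qPochInf ((q : ℂ) ^ 2) ((q : ℂ) ^ 2) ≠ 0 :=
    qPochInf_ne_zero hn2 (mul_pow_ne_one_of_norm hn2 hn2)
  have hu : ((1 - q : ℝ) : ℂ) ≠ 0 := Complex.ofReal_ne_zero.2 (by linarith)
  have hw : ((1 + q : ℝ) : ℂ) ≠ 0 := Complex.ofReal_ne_zero.2 (by linarith)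
  have hpow : ∀ x : ℂ, ((1 - q ^ 2 : ℝ) : ℂ) ^ x =
      ((1 - q : ℝ) : ℂ) ^ x * ((1 + q : ℝ) : ℂ) ^ x := by
    intro x
    rw [show 1 - q ^ 2 = (1 - q) * (1 + q) by ring, Complex.ofReal_mul,
      Complex.mul_cpow_ofReal_nonneg (by linarith) (by linarith)]
  have e1 : ∀ d : ℂ, ((q ^ 2 : ℝ) : ℂ) ^ (d + 1) = ((q : ℂ) ^ d) ^ 2 * (q : ℂ) ^ 2 := by
    intro d
    rw [ofReal_sq_cpow hq, mul_add, mul_one, ofReal_cpow_two_mul_add_two hq]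
  have e2 : ((q ^ 2 : ℝ) : ℂ) ^ (1 / 2 : ℂ) = q := by
    rw [ofReal_sq_cpow hq]; norm_num
  have e3 : (q : ℂ) ^ (b + c + 1 / 2) = (q : ℂ) ^ b * (q : ℂ) ^ c * (q : ℂ) ^ (1 / 2 : ℂ) := by
    rw [Complex.cpow_add _ _ h0, Complex.cpow_add _ _ h0]
  -- All powers of 1 - q and 1 + q in the q-gamma quotient cancel, using 1 - q² = (1 - q)(1 + q).
  have hpw : ((1 - q : ℝ) : ℂ) * ((1 + q : ℝ) : ℂ) ^ (b + c + 1 / 2) *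
      ((1 - q ^ 2 : ℝ) : ℂ) ^ (1 - (b + 1)) * ((1 - q ^ 2 : ℝ) : ℂ) ^ (1 - (c + 1)) =
      ((1 - q ^ 2 : ℝ) : ℂ) ^ (1 - 1 / 2 : ℂ) * ((1 - q : ℝ) : ℂ) ^ (1 - (b + c + 1 / 2)) := by
    rw [hpow, hpow, hpow]
    conv_lhs => rw [← Complex.cpow_one ((1 - q : ℝ) : ℂ)]
    have hL : ((1 - q : ℝ) : ℂ) ^ (1 : ℂ) * ((1 - q : ℝ) : ℂ) ^ (1 - (b + 1)) *
        ((1 - q : ℝ) : ℂ) ^ (1 - (c + 1)) =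
        ((1 - q : ℝ) : ℂ) ^ (1 - 1 / 2 : ℂ) * ((1 - q : ℝ) : ℂ) ^ (1 - (b + c + 1 / 2)) := by
      rw [← Complex.cpow_add _ _ hu, ← Complex.cpow_add _ _ hu, ← Complex.cpow_add _ _ hu]
      ring_nf
    have hR : ((1 + q : ℝ) : ℂ) ^ (b + c + 1 / 2) * ((1 + q : ℝ) : ℂ) ^ (1 - (b + 1)) *
        ((1 + q : ℝ) : ℂ) ^ (1 - (c + 1)) = ((1 + q : ℝ) : ℂ) ^ (1 - 1 / 2 : ℂ) := by
      rw [← Complex.cpow_add _ _ hw, ← Complex.cpow_add _ _ hw]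
      ring_nf
    simp only [Complex.cpow_one] at hL ⊢
    linear_combination (((1 + q : ℝ) : ℂ) ^ (b + c + 1 / 2) * ((1 + q : ℝ) : ℂ) ^ (1 - (b + 1)) *
        ((1 + q : ℝ) : ℂ) ^ (1 - (c + 1))) * hL + (((1 - q : ℝ) : ℂ) ^ (1 - 1 / 2 : ℂ) *
        ((1 - q : ℝ) : ℂ) ^ (1 - (b + c + 1 / 2))) * hR
  have m1 : ((1 - q ^ 2 : ℝ) : ℂ) ^ (1 - 1 / 2 : ℂ) ≠ 0 := by
    rw [Complex.cpow_ne_zero_iff]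
    exact Or.inl (Complex.ofReal_ne_zero.2 (by nlinarith))
  have m2 : ((1 - q : ℝ) : ℂ) ^ (1 - (b + c + 1 / 2)) ≠ 0 := by
    rw [Complex.cpow_ne_zero_iff]
    exact Or.inl hu
  rw [valueC, qGamma, qGamma, qGamma, qGamma, e1, e1, e2, e3, qPochInf_self_split hn,
    show 1 - (q : ℂ) = ((1 - q : ℝ) : ℂ) by push_cast; rfl,
    show 1 + (q : ℂ) = ((1 + q : ℝ) : ℂ) by push_cast; rfl, Complex.ofReal_pow]
  -- No condition x ≠ 0 is needed: at a pole of Γ_q(b + c + 1/2) division by zero gives 0 on the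
  -- left, in agreement with x = 0 on the right.
  generalize qPochInf ((q : ℂ) ^ b * (q : ℂ) ^ c * (q : ℂ) ^ (1 / 2 : ℂ)) q = x
  generalize qPochInf (((q : ℂ) ^ b) ^ 2 * (q : ℂ) ^ 2) ((q : ℂ) ^ 2) = y
  generalize qPochInf (((q : ℂ) ^ c) ^ 2 * (q : ℂ) ^ 2) ((q : ℂ) ^ 2) = z
  generalize qPochInf (q : ℂ) ((q : ℂ) ^ 2) = i at *
  generalize qPochInf ((q : ℂ) ^ 2) ((q : ℂ) ^ 2) = j at *
  have hm := mul_ne_zero m1 m2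
  rw [show ((1 - q : ℝ) : ℂ) * ((1 + q : ℝ) : ℂ) ^ (b + c + 1 / 2) *
      (j / y * ((1 - q ^ 2 : ℝ) : ℂ) ^ (1 - (b + 1))) *
      (j / z * ((1 - q ^ 2 : ℝ) : ℂ) ^ (1 - (c + 1))) = j ^ 2 / (y * z) *
      (((1 - q : ℝ) : ℂ) * ((1 + q : ℝ) : ℂ) ^ (b + c + 1 / 2) *
      ((1 - q ^ 2 : ℝ) : ℂ) ^ (1 - (b + 1)) * ((1 - q ^ 2 : ℝ) : ℂ) ^ (1 - (c + 1))) by ring, hpw,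
    show j / i * ((1 - q ^ 2 : ℝ) : ℂ) ^ (1 - 1 / 2 : ℂ) *
      (i * j / x * ((1 - q : ℝ) : ℂ) ^ (1 - (b + c + 1 / 2))) = j / i * (i * j / x) *
      (((1 - q ^ 2 : ℝ) : ℂ) ^ (1 - 1 / 2 : ℂ) * ((1 - q : ℝ) : ℂ) ^ (1 - (b + c + 1 / 2))) by ring,
    mul_div_mul_right _ _ hm]
  rw [show j / i * (i * j / x) = j ^ 2 / x by field_simp, div_div_eq_mul_div]
  field_simp

theorem admissible_of_cpow_ne_one (hq : 0 < q) {b : ℂ}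
    (hb : ∀ m : ℕ, (q : ℂ) ^ (2 * b + 2 + 2 * m) ≠ 1) (m : ℕ) :
    ((q : ℂ) ^ b) ^ 2 * (q : ℂ) ^ 2 * ((q : ℂ) ^ 2) ^ m ≠ 1 := by
  have h0 : (q : ℂ) ≠ 0 := Complex.ofReal_ne_zero.2 hq.ne'
  have h := hb m
  rwa [Complex.cpow_add _ _ h0, ofReal_cpow_two_mul_add_two hq,
    show (2 * m : ℂ) = (2 * m : ℕ) by push_cast; rfl, Complex.cpow_natCast, pow_mul] at h

theorem three_parameter_identity (hq : 0 < q) (hq1 : q < 1) {b c : ℂ}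
    (hb : ∀ m : ℕ, (q : ℂ) ^ (2 * b + 2 + 2 * m) ≠ 1)
    (hc : ∀ m : ℕ, (q : ℂ) ^ (2 * c + 2 + 2 * m) ≠ 1) {a : ℂ} (ha : 0 < a.re) :
    Summable (seriesA q a b c) ∧ Summable (seriesB q a b c) ∧
      (1 - (q : ℂ) ^ (2 * a)) * ∑' k, seriesA q a b c k = -∑' n, seriesB q a b c n := by
  have hA1 : ‖(q : ℂ) ^ a‖ < 1 := by
    rw [Complex.norm_cpow_eq_rpow_re_of_pos hq]
    exact Real.rpow_lt_one hq.le hq1 ha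
  have hs := ofReal_cpow_half_sq q
  have h0 : (q : ℂ) ≠ 0 := Complex.ofReal_ne_zero.2 hq.ne'
  have hn := norm_ofReal_lt_one hq hq1
  have nz := ofReal_cpow_ne_zero hq
  have hB := admissible_of_cpow_ne_one hq hb
  have hC := admissible_of_cpow_ne_one hq hc
  rw [funext (seriesA_eq_phiTerm hq a b c), funext (seriesB_eq_accTerm hq a b c),
    Complex.cpow_ofNat_mul]
  exact ⟨summable_phiTerm h0 hn (nz a) hA1 hB hC, summable_accTerm hs h0 hn (nz a) (nz b) (nz c),
    tsum_phiTerm_eq hs h0 hn (nz a) (nz b) (nz c) hA1 hB hC⟩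

theorem two_parameter_identity (hq : 0 < q) (hq1 : q < 1) {b c : ℂ}
    (hb : ∀ m : ℕ, (q : ℂ) ^ (2 * b + 2 + 2 * m) ≠ 1)
    (hc : ∀ m : ℕ, (q : ℂ) ^ (2 * c + 2 + 2 * m) ≠ 1) :
    HasSum (seriesC q b c) (valueC q b c) := by
  have nz := ofReal_cpow_ne_zero hq
  have h := (hasSum_accTerm_one (ofReal_cpow_half_sq q) (Complex.ofReal_ne_zero.2 hq.ne')
    (norm_ofReal_lt_one hq hq1) (nz b) (nz c) (admissible_of_cpow_ne_one hq hb)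
    (admissible_of_cpow_ne_one hq hc)).neg
  rw [neg_neg] at h
  rw [valueC_eq hq hq1, funext (seriesC_eq_neg_accTerm hq b c)]
  exact h

theorem seriesC_sq_zero (hq : 0 < q) (hq1 : q < 1) (n : ℕ) :
    seriesC (q ^ 2) 0 0 n = seriesD q n := by
  have e2 : ((q ^ 2 : ℝ) : ℂ) ^ (1 / 2 : ℂ) = q := by
    rw [ofReal_sq_cpow hq]; norm_num
  rw [seriesC_eq_neg_accTerm (by positivity), e2, Complex.cpow_zero, accTerm, seriesD]
  have hne : (1 - (q : ℂ) ^ (2 * n + 1)) ≠ 0 := by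
    rw [pow_succ']
    exact sub_ne_zero.2 (mul_pow_ne_one_of_norm (norm_ofReal_lt_one hq hq1)
      (norm_ofReal_lt_one hq hq1) _).symm
  simp only [one_pow, one_mul, mul_one, div_one, Complex.ofReal_pow, certPoly, ← pow_mul]
  norm_num only
  -- In the two-parameter form numerator and denominator share the factor (1 - q^(2n+1))², already
  -- cancelled in `seriesD`; it is restored on the right below.
  rw [show 1 - (q : ℂ) ^ 4 * (q : ℂ) ^ (4 * (2 * n)) = (1 - (q : ℂ) ^ (2 * n + 1)) *
    (((q : ℂ) ^ (2 * n + 1) + 1) * ((q : ℂ) ^ (4 * n + 2) + 1)) by ring]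
  generalize qPoch (q : ℂ) ((q : ℂ) ^ 2) n = x
  generalize qPoch (q : ℂ) ((q : ℂ) ^ 2) (3 * n) = y
  generalize qPoch ((q : ℂ) ^ 4) ((q : ℂ) ^ 4) n = z
  generalize qPoch ((q : ℂ) ^ 4) ((q : ℂ) ^ 4) (2 * n) = w
  rw [← neg_div, show ∀ u v : ℂ, u * v * (u * v) * z * (w * w) = u ^ 2 * (v ^ 2 * z * w ^ 2) from
    fun u v => by ring]
  conv_rhs => rw [← mul_div_mul_left _ _ (pow_ne_zero 2 hne)]
  congr 1 <;> ring

theorem valueC_sq_zero (hq : 0 < q) (hq1 : q < 1) : valueC (q ^ 2) 0 0 = valueD q := by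
  have hp : ((q ^ 2) ^ 2 : ℝ) = q ^ 4 := by ring
  have hg : qGamma (q ^ 4) 1 = 1 := by
    have hn : ‖((q ^ 4 : ℝ) : ℂ)‖ < 1 :=
      norm_ofReal_lt_one (by positivity) (pow_lt_one₀ hq.le hq1 (by norm_num))
    rw [qGamma, Complex.cpow_one, sub_self, Complex.cpow_zero, mul_one,
      div_self (qPochInf_ne_zero hn (mul_pow_ne_one_of_norm hn hn))]
  simp only [valueC, valueD, hp, zero_add, hg, mul_one]
  rw [mul_comm (qGamma (q ^ 4) _), Real.sqrt_eq_rpow, Complex.ofReal_cpow (by positivity)]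
  push_cast
  rfl

theorem one_variable_identity (hq : 0 < q) (hq1 : q < 1) : HasSum (seriesD q) (valueD q) := by
  have hq2 : q ^ 2 < 1 := pow_lt_one₀ hq.le hq1 two_ne_zero
  have h0 : ∀ m : ℕ, ((q ^ 2 : ℝ) : ℂ) ^ (2 * 0 + 2 + 2 * m : ℂ) ≠ 1 := by
    intro m
    rw [show (2 * 0 + 2 + 2 * m : ℂ) = (2 * m + 1 + 1 : ℕ) by push_cast; ring, Complex.cpow_natCast,
      pow_succ']
    exact mul_pow_ne_one_of_norm (norm_ofReal_lt_one (by positivity) hq2)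
      (norm_ofReal_lt_one (by positivity) hq2) _
  have h := two_parameter_identity (by positivity) hq2 h0 h0
  rwa [valueC_sq_zero hq hq1, funext (seriesC_sq_zero hq hq1)] at h

end Translation

/-! ### The limit of Γ_(q²)(1/2) through a q-Wallis product. -/

section Limits

theorem tendsto_one_sub_pow_div (e : ℕ) :
    Tendsto (fun q : ℝ => (1 - q ^ e) / (1 - q)) (𝓝[<] 1) (𝓝 e) := by
  have h : Tendsto (fun q : ℝ => ∑ i ∈ Finset.range e, q ^ i) (𝓝[<] 1) (𝓝 e) := by
    have hc : Continuous fun q : ℝ => ∑ i ∈ Finset.range e, q ^ i := by fun_prop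
    simpa using (hc.tendsto 1).mono_left nhdsWithin_le_nhds
  refine h.congr' ?_
  filter_upwards [self_mem_nhdsWithin] with q hq
  have hq' : 1 - q ≠ 0 := sub_ne_zero.2 (ne_of_gt hq)
  rw [eq_div_iff hq', mul_comm, mul_neg_geom_sum]

theorem eventually_mem_Ioo_zero_one : ∀ᶠ q : ℝ in 𝓝[<] 1, 0 < q ∧ q < 1 :=
  Ioo_mem_nhdsLT one_pos

theorem tendsto_sq_nhdsLT_one : Tendsto (fun q : ℝ => q ^ 2) (𝓝[<] 1) (𝓝[<] 1) := by
  refine tendsto_nhdsWithin_iff.2 ⟨?_, ?_⟩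
  · simpa using ((continuous_pow 2).tendsto (1 : ℝ)).mono_left nhdsWithin_le_nhds
  · filter_upwards [eventually_mem_Ioo_zero_one] with q hq
    exact pow_lt_one₀ hq.1.le hq.2 two_ne_zero

noncomputable section

/-- The partial products of the `q`-analogue of the Wallis product. -/
def qWallis (r : ℝ) (n : ℕ) : ℝ :=
  ∏ i ∈ Finset.range n, (1 - r ^ (2 * i + 2)) / (1 - r ^ (2 * i + 1)) *
    ((1 - r ^ (2 * i + 2)) / (1 - r ^ (2 * i + 3)))

/-- The finite `q`-shifted factorial over the reals. -/
def realPoch (a q : ℝ) (n : ℕ) : ℝ := ∏ j ∈ Finset.range n, (1 - a * q ^ j)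

end

theorem ofReal_realPoch (a q : ℝ) (n : ℕ) : (realPoch a q n : ℂ) = qPoch a q n := by
  simp [realPoch, qPoch]

theorem realPoch_succ (a q : ℝ) (n : ℕ) :
    realPoch a q (n + 1) = realPoch a q n * (1 - a * q ^ n) := by
  simp [realPoch, Finset.prod_range_succ]

theorem realPoch_pos {a q : ℝ} (ha0 : 0 ≤ a) (ha : a < 1) (hq0 : 0 ≤ q) (hq : q ≤ 1) (n : ℕ) :
    0 < realPoch a q n :=
  Finset.prod_pos fun _ _ =>
    sub_pos.2 (mul_lt_one_of_nonneg_of_lt_one_left ha0 ha (pow_le_one₀ hq0 hq))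

/-- Divided by 1 - t², this is the arithmetic-geometric mean inequality for 1, t², ..., t^(2N). -/
theorem mul_pow_mul_one_sub_le {t : ℝ} (h0 : 0 ≤ t) (h1 : t ≤ 1) (N : ℕ) :
    (N + 1) * t ^ N * (1 - t ^ 2) ≤ 1 - (t ^ 2) ^ (N + 1) := by
  induction N with
  | zero => simp
  | succ N ih =>
    -- After removal of the factor t^N (1 - t²), the induction step is Bernoulli's inequality (N+2)t
    -- ≤ N + 1 + t^(N+2).
    have hb := one_add_mul_le_pow (a := t - 1) (by linarith) (N + 2)
    rw [add_sub_cancel] at hb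
    have h2 : 0 ≤ t ^ N * (1 - t ^ 2) := mul_nonneg (by positivity) (by nlinarith)
    have h3 := mul_le_mul_of_nonneg_left hb h2
    push_cast at h3 ⊢
    have e1 : (t ^ 2) ^ (N + 1 + 1) = (t ^ 2) ^ (N + 1) * t ^ 2 := by ring
    have e2 : t ^ N * (1 - t ^ 2) * t ^ (N + 2) = (t ^ 2) ^ (N + 1) * (1 - t ^ 2) := by ring
    rw [e2] at h3
    rw [e1, pow_succ]
    linarith

theorem sq_mul_pow_le {r : ℝ} (h0 : 0 ≤ r) (h1 : r ≤ 1) (N : ℕ) :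
    (N + 1) ^ 2 * (r ^ N * (1 - r) ^ 2) ≤ (1 - r ^ (N + 1)) ^ 2 := by
  have h := mul_pow_mul_one_sub_le (Real.sqrt_nonneg r) (Real.sqrt_le_one.2 h1) N
  rw [Real.sq_sqrt h0] at h
  have h2 := pow_le_pow_left₀ (mul_nonneg (by positivity) (by linarith)) h 2
  calc _ = ((N + 1) * √r ^ N * (1 - r)) ^ 2 := by
        rw [mul_pow, mul_pow, ← pow_mul, mul_comm N 2, pow_mul, Real.sq_sqrt h0]
        ring
    _ ≤ _ := h2

theorem one_le_qWallis_factor {r : ℝ} (h0 : 0 < r) (h1 : r < 1) (i : ℕ) :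
    1 ≤ (1 - r ^ (2 * i + 2)) / (1 - r ^ (2 * i + 1)) *
      ((1 - r ^ (2 * i + 2)) / (1 - r ^ (2 * i + 3))) := by
  have p1 : 0 < 1 - r ^ (2 * i + 1) := sub_pos.2 (pow_lt_one₀ h0.le h1 (by omega))
  have p3 : 0 < 1 - r ^ (2 * i + 3) := sub_pos.2 (pow_lt_one₀ h0.le h1 (by omega))
  rw [div_mul_div_comm, one_le_div (by positivity)]
  have : 0 ≤ r ^ (2 * i + 1) * (1 - r) ^ 2 := by positivity
  linear_combination this

/-- With m = 2i + 2 and D = 1 - r^m, the left side is D²/(D² - r^(m-1)(1-r)²) and the right side is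
m²/(m² - 1). The comparison is thus m² r^(m-1) (1-r)² ≤ D², an instance of `sq_mul_pow_le`. -/
theorem qWallis_factor_le {r : ℝ} (h0 : 0 < r) (h1 : r < 1) (i : ℕ) :
    (1 - r ^ (2 * i + 2)) / (1 - r ^ (2 * i + 1)) *
      ((1 - r ^ (2 * i + 2)) / (1 - r ^ (2 * i + 3))) ≤
    (2 * i + 2) / (2 * i + 1) * ((2 * i + 2) / (2 * i + 3)) := by
  have p1 : 0 < 1 - r ^ (2 * i + 1) := sub_pos.2 (pow_lt_one₀ h0.le h1 (by omega))
  have p3 : 0 < 1 - r ^ (2 * i + 3) := sub_pos.2 (pow_lt_one₀ h0.le h1 (by omega))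
  rw [div_mul_div_comm, div_mul_div_comm, div_le_div_iff₀ (by positivity) (by positivity)]
  have h := sq_mul_pow_le h0.le h1.le (2 * i + 1)
  push_cast at h
  linear_combination h

theorem qWallis_le {r : ℝ} (h0 : 0 < r) (h1 : r < 1) (n : ℕ) : qWallis r n ≤ Real.pi / 2 :=
  (Finset.prod_le_prod (fun i _ => zero_le_one.trans (one_le_qWallis_factor h0 h1 i))
    fun i _ => qWallis_factor_le h0 h1 i).trans (Real.Wallis.W_le n)

theorem monotone_qWallis {r : ℝ} (h0 : 0 < r) (h1 : r < 1) : Monotone (qWallis r) := by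
  refine monotone_nat_of_le_succ fun n => ?_
  rw [qWallis, qWallis, Finset.prod_range_succ]
  exact le_mul_of_one_le_right
    (Finset.prod_nonneg fun i _ => zero_le_one.trans (one_le_qWallis_factor h0 h1 i))
    (one_le_qWallis_factor h0 h1 n)

theorem tendsto_qWallis (n : ℕ) :
    Tendsto (fun r => qWallis r n) (𝓝[<] 1) (𝓝 (Real.Wallis.W n)) := by
  refine tendsto_finsetProd _ fun i _ => ?_
  have h1 := tendsto_one_sub_pow_div (2 * i + 1)
  have h2 := tendsto_one_sub_pow_div (2 * i + 2)
  have h3 := tendsto_one_sub_pow_div (2 * i + 3)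
  have h := (h2.div h1 (by positivity)).mul (h2.div h3 (by positivity))
  push_cast at h
  refine h.congr' ?_
  filter_upwards [self_mem_nhdsWithin] with q hq
  have hq' : 1 - q ≠ 0 := sub_ne_zero.2 (ne_of_gt hq)
  simp only [Pi.div_apply]
  rw [div_div_div_cancel_right₀ hq', div_div_div_cancel_right₀ hq']

theorem realPoch_sq_div {r : ℝ} (h0 : 0 < r) (h1 : r < 1) (n : ℕ) :
    (1 - r ^ 2) * (realPoch (r ^ 2) (r ^ 2) n / realPoch r (r ^ 2) n) ^ 2 =
      (1 + r) * (1 - r ^ (2 * n + 1)) * qWallis r n := by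
  induction n with
  | zero => simp [realPoch, qWallis]; ring
  | succ n ih =>
    have p1 : 1 - r ^ (2 * n + 1) ≠ 0 := (sub_pos.2 (pow_lt_one₀ h0.le h1 (by omega))).ne'
    have p3 : 1 - r ^ (2 * n + 3) ≠ 0 := (sub_pos.2 (pow_lt_one₀ h0.le h1 (by omega))).ne'
    rw [realPoch_succ, realPoch_succ, qWallis, Finset.prod_range_succ, ← qWallis,
      show r ^ 2 * (r ^ 2) ^ n = r ^ (2 * n + 2) by ring,
      show r * (r ^ 2) ^ n = r ^ (2 * n + 1) by ring, mul_div_mul_comm, mul_pow, ← mul_assoc, ih,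
      show 2 * (n + 1) + 1 = 2 * n + 3 by ring]
    field_simp

theorem tendsto_qGamma_half {r : ℝ} (h0 : 0 < r) (h1 : r < 1) :
    Tendsto (fun n => ((realPoch (r ^ 2) (r ^ 2) n / realPoch r (r ^ 2) n * √(1 - r ^ 2) : ℝ) : ℂ))
      atTop (𝓝 (qGamma (r ^ 2) (1 / 2))) := by
  have hr2 : r ^ 2 < 1 := pow_lt_one₀ h0.le h1 two_ne_zero
  have hn := norm_ofReal_lt_one h0 h1
  have hn2 := norm_ofReal_lt_one (by positivity) hr2
  have e2 : ((r ^ 2 : ℝ) : ℂ) ^ (1 / 2 : ℂ) = r := by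
    rw [ofReal_sq_cpow h0]; norm_num
  have e3 : ((1 - r ^ 2 : ℝ) : ℂ) ^ (1 - 1 / 2 : ℂ) = (√(1 - r ^ 2) : ℝ) := by
    rw [Real.sqrt_eq_rpow, Complex.ofReal_cpow (by linarith)]
    norm_num
  rw [qGamma, e2, e3]
  have h := ((tendsto_qPoch ((r ^ 2 : ℝ) : ℂ) hn2).div (tendsto_qPoch (r : ℂ) hn2)
    (qPochInf_ne_zero hn2 (mul_pow_ne_one_of_norm hn hn2))).mul_const ((√(1 - r ^ 2) : ℝ) : ℂ)
  refine h.congr fun n => ?_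
  rw [Complex.ofReal_mul, Complex.ofReal_div, ofReal_realPoch, ofReal_realPoch]
  rfl

theorem qGamma_half_eq_ofReal {r : ℝ} (h0 : 0 < r) (h1 : r < 1) :
    qGamma (r ^ 2) (1 / 2) = ((qGamma (r ^ 2) (1 / 2)).re : ℂ) := by
  have h := tendsto_qGamma_half h0 h1
  have h2 := (Complex.continuous_ofReal.tendsto _).comp ((Complex.continuous_re.tendsto _).comp h)
  exact tendsto_nhds_unique h h2

theorem qGamma_half_re_nonneg {r : ℝ} (h0 : 0 < r) (h1 : r < 1) :
    0 ≤ (qGamma (r ^ 2) (1 / 2)).re := by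
  have hr2 : r ^ 2 < 1 := pow_lt_one₀ h0.le h1 two_ne_zero
  have h := (Complex.continuous_re.tendsto _).comp (tendsto_qGamma_half h0 h1)
  refine ge_of_tendsto' h fun n => ?_
  simp only [Function.comp, Complex.ofReal_re]
  have := realPoch_pos (sq_nonneg r) hr2 (sq_nonneg r) hr2.le n
  have := realPoch_pos h0.le h1 (sq_nonneg r) hr2.le n
  positivity

theorem tendsto_qWallis_atTop {r : ℝ} (h0 : 0 < r) (h1 : r < 1) :
    Tendsto (qWallis r) atTop (𝓝 ((qGamma (r ^ 2) (1 / 2)).re ^ 2 / (1 + r))) := by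
  have hr2 : 0 ≤ 1 - r ^ 2 := by nlinarith
  have h := ((Complex.continuous_re.tendsto _).comp (tendsto_qGamma_half h0 h1)).pow 2
  have hp : Tendsto (fun n : ℕ => (1 + r) * (1 - r * (r ^ 2) ^ n)) atTop (𝓝 (1 + r)) := by
    have := (tendsto_pow_atTop_nhds_zero_of_lt_one (sq_nonneg r)
      (pow_lt_one₀ h0.le h1 two_ne_zero)).const_mul r
    simpa using (this.const_sub 1).const_mul (1 + r)
  refine (h.div hp (by positivity)).congr fun n => ?_
  have p1 : 1 - r ^ (2 * n + 1) ≠ 0 := (sub_pos.2 (pow_lt_one₀ h0.le h1 (by omega))).ne'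
  have hW := realPoch_sq_div h0 h1 n
  simp only [Function.comp, Complex.ofReal_re, Pi.div_apply]
  rw [mul_pow, Real.sq_sqrt hr2, mul_comm _ (1 - r ^ 2), hW,
    show r * (r ^ 2) ^ n = r ^ (2 * n + 1) by ring]
  field_simp

/-- The limits n → ∞ and r → 1 are interchanged by monotonicity. From below, fix n with W(n) near
π/2 and use that the q-products increase in n; from above, π/2 bounds them for every r. -/
theorem tendsto_qGamma_half_re :
    Tendsto (fun q : ℝ => (qGamma (q ^ 2) (1 / 2)).re) (𝓝[<] 1) (𝓝 √Real.pi) := by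
  have h : Tendsto (fun q : ℝ => (qGamma (q ^ 2) (1 / 2)).re ^ 2 / (1 + q)) (𝓝[<] 1)
      (𝓝 (Real.pi / 2)) := by
    refine tendsto_order.2 ⟨fun x hx => ?_, fun x hx => ?_⟩
    · obtain ⟨n, hn⟩ := (Real.Wallis.tendsto_W_nhds_pi_div_two.eventually_const_lt hx).exists
      filter_upwards [(tendsto_qWallis n).eventually_const_lt hn, eventually_mem_Ioo_zero_one]
        with q hq hq1
      exact hq.trans_le ((monotone_qWallis hq1.1 hq1.2).ge_of_tendsto
        (tendsto_qWallis_atTop hq1.1 hq1.2) n)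
    · filter_upwards [eventually_mem_Ioo_zero_one] with q hq1
      exact (le_of_tendsto' (tendsto_qWallis_atTop hq1.1 hq1.2)
        (qWallis_le hq1.1 hq1.2)).trans_lt hx
  have h1 : Tendsto (fun q : ℝ => 1 + q) (𝓝[<] 1) (𝓝 (1 + 1)) :=
    ((continuous_const.add continuous_id).tendsto (1 : ℝ)).mono_left nhdsWithin_le_nhds
  have h2 := (h.mul h1).sqrt
  rw [show Real.pi / 2 * (1 + 1) = Real.pi by ring] at h2
  refine h2.congr' ?_
  filter_upwards [eventually_mem_Ioo_zero_one] with q hq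
  have : 1 + q ≠ 0 := by linarith [hq.1]
  rw [div_mul_cancel₀ _ this, Real.sqrt_sq (qGamma_half_re_nonneg hq.1 hq.2)]

theorem tendsto_valueD :
    Tendsto (fun q : ℝ => valueD q / (1 - (q : ℂ) ^ 2)) (𝓝[<] 1)
      (𝓝 ((Real.sqrt 2 / Real.pi : ℝ) : ℂ)) := by
  have h1 := tendsto_qGamma_half_re
  have h2 := h1.comp tendsto_sq_nhdsLT_one
  have h3 : Tendsto (fun q : ℝ => √(1 + q ^ 2)) (𝓝[<] 1) (𝓝 √2) := by
    have hc : Continuous fun q : ℝ => √(1 + q ^ 2) := by fun_prop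
    have := (hc.tendsto 1).mono_left (nhdsWithin_le_nhds (s := Set.Iio 1))
    norm_num at this
    exact this
  have hpi : √Real.pi * √Real.pi = Real.pi := Real.mul_self_sqrt Real.pi_pos.le
  have h := h3.div (h1.mul h2) (by rw [hpi]; exact Real.pi_ne_zero)
  rw [hpi] at h
  refine ((Complex.continuous_ofReal.tendsto _).comp h).congr' ?_
  filter_upwards [eventually_mem_Ioo_zero_one] with q hq
  have hq2 : q ^ 2 < 1 := pow_lt_one₀ hq.1.le hq.2 two_ne_zero
  have hne : 1 - (q : ℂ) ^ 2 ≠ 0 := by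
    rw [← Complex.ofReal_pow, ← Complex.ofReal_one, ← Complex.ofReal_sub, Complex.ofReal_ne_zero]
    linarith
  have e4 := qGamma_half_eq_ofReal (pow_pos hq.1 2) hq2
  rw [valueD, show q ^ 4 = (q ^ 2) ^ 2 by ring, qGamma_half_eq_ofReal hq.1 hq.2, e4]
  simp only [Function.comp, Pi.div_apply, Complex.ofReal_div, Complex.ofReal_mul]
  field_simp

end Limits

/-! ### Uniform bounds and termwise limits as q → 1⁻, and the classical series. -/

noncomputable section

/-- The numerator polynomial of `seriesD`, over the reals. -/
def numD (q : ℝ) (n : ℕ) : ℝ :=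
  2 * q ^ (2 * n + 1) + 3 * q ^ (4 * n + 2) + 4 * q ^ (6 * n + 3)
    + 3 * q ^ (8 * n + 4) - q ^ (10 * n + 1) - q ^ (10 * n + 3)
    + 2 * q ^ (10 * n + 5) - 2 * q ^ (12 * n + 2) + q ^ (12 * n + 6)
    - 3 * q ^ (14 * n + 3) - 3 * q ^ (16 * n + 4) - 3 * q ^ (18 * n + 5)
    - 2 * q ^ (20 * n + 6) - q ^ (22 * n + 7) + 1

/-- The hypergeometric part of `seriesD`, over the reals and without its sign. -/
def hypD (q : ℝ) (n : ℕ) : ℝ :=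
  q ^ (7 * n ^ 2) * (realPoch q (q ^ 2) (3 * n) * realPoch q (q ^ 2) n ^ 2) /
    (realPoch (q ^ 4) (q ^ 4) n * realPoch (q ^ 4) (q ^ 4) (2 * n) ^ 2)

end

section SeriesD

theorem seriesD_div_eq (q : ℝ) (n : ℕ) :
    seriesD q n / (1 - (q : ℂ) ^ 2) =
      (((-1) ^ n * hypD q n * (numD q n / (1 - q ^ 2)) /
        ((q ^ (2 * n + 1) + 1) ^ 2 * (q ^ (4 * n + 2) + 1) ^ 2) : ℝ) : ℂ) := by
  rw [seriesD, hypD, numD]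
  push_cast [ofReal_realPoch]
  generalize (q : ℂ) ^ (2 * n + 1) + 1 = u
  generalize (q : ℂ) ^ (4 * n + 2) + 1 = v
  ring

theorem hypD_nonneg {q : ℝ} (h0 : 0 < q) (h1 : q < 1) (n : ℕ) : 0 ≤ hypD q n := by
  have h2 : q ^ 2 ≤ 1 := pow_le_one₀ h0.le h1.le
  have h4 : q ^ 4 < 1 := pow_lt_one₀ h0.le h1 (by norm_num)
  have := realPoch_pos h0.le h1 (sq_nonneg q) h2 (3 * n)
  have := realPoch_pos (by positivity) h4 (by positivity) h4.le n
  unfold hypD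
  positivity

theorem hypD_succ {q : ℝ} (n : ℕ) :
    hypD q (n + 1) = hypD q n * (q ^ (14 * n + 7) *
      ((1 - q ^ (6 * n + 1)) * (1 - q ^ (6 * n + 3)) * (1 - q ^ (6 * n + 5)) *
        (1 - q ^ (2 * n + 1)) ^ 2) /
      ((1 - q ^ (4 * n + 4)) * ((1 - q ^ (8 * n + 4)) * (1 - q ^ (8 * n + 8))) ^ 2)) := by
  rw [hypD, hypD, show 3 * (n + 1) = 3 * n + 1 + 1 + 1 by ring, show 2 * (n + 1) = 2 * n + 1 + 1 by
    ring, div_mul_div_comm]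
  simp only [realPoch_succ]
  rw [show q * (q ^ 2) ^ (3 * n) = q ^ (6 * n + 1) by ring,
    show q * (q ^ 2) ^ (3 * n + 1) = q ^ (6 * n + 3) by ring,
    show q * (q ^ 2) ^ (3 * n + 1 + 1) = q ^ (6 * n + 5) by ring,
    show q * (q ^ 2) ^ n = q ^ (2 * n + 1) by ring,
    show q ^ 4 * (q ^ 4) ^ n = q ^ (4 * n + 4) by ring,
    show q ^ 4 * (q ^ 4) ^ (2 * n) = q ^ (8 * n + 4) by ring,
    show q ^ 4 * (q ^ 4) ^ (2 * n + 1) = q ^ (8 * n + 8) by ring,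
    show q ^ (7 * (n + 1) ^ 2) = q ^ (7 * n ^ 2) * q ^ (14 * n + 7) by ring]
  generalize 1 - q ^ (6 * n + 1) = x1
  generalize 1 - q ^ (6 * n + 3) = x2
  generalize 1 - q ^ (6 * n + 5) = x3
  generalize 1 - q ^ (2 * n + 1) = x4
  generalize 1 - q ^ (4 * n + 4) = x5
  generalize 1 - q ^ (8 * n + 4) = x6
  generalize 1 - q ^ (8 * n + 8) = x7
  congr 1 <;> ring

/-- Powers of q give no decay uniformly as q → 1, so the constant must come from the factors.
Enlarging exponents in the numerator cancels most of the denominator, and with y = q^(2n+2) what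
remains is 4y ≤ (1 + y)²(1 + y²). -/
theorem hypD_ratio_le {q : ℝ} (h0 : 0 < q) (h1 : q < 1) (n : ℕ) :
    q ^ (14 * n + 7) *
      ((1 - q ^ (6 * n + 1)) * (1 - q ^ (6 * n + 3)) * (1 - q ^ (6 * n + 5)) *
        (1 - q ^ (2 * n + 1)) ^ 2) /
      ((1 - q ^ (4 * n + 4)) * ((1 - q ^ (8 * n + 4)) * (1 - q ^ (8 * n + 8))) ^ 2) ≤ 1 / 4 := by
  have pos : ∀ m : ℕ, 0 < 1 - q ^ (m + 1) := fun m =>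
    sub_pos.2 (pow_lt_one₀ h0.le h1 (Nat.succ_ne_zero m))
  have mono : ∀ {i j : ℕ}, i ≤ j → 1 - q ^ i ≤ 1 - q ^ j := fun h =>
    sub_le_sub_left (pow_le_pow_of_le_one h0.le h1.le h) 1
  have p1 := pos (6 * n)
  have p2 := pos (6 * n + 2)
  have p3 := pos (6 * n + 4)
  have p4 := pos (2 * n)
  have p5 := pos (4 * n + 3)
  have p6 := pos (8 * n + 3)
  have p7 := pos (8 * n + 7)
  have py := pos (2 * n + 1)
  rw [div_le_iff₀ (by positivity)]
  have hy0 : 0 < q ^ (2 * n + 2) := by positivity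
  have e5 : 1 - q ^ (4 * n + 4) = (1 - q ^ (2 * n + 2)) * (1 + q ^ (2 * n + 2)) := by ring
  have e7 : 1 - q ^ (8 * n + 8) =
      (1 - q ^ (2 * n + 2)) * ((1 + q ^ (2 * n + 2)) * (1 + q ^ (4 * n + 4))) := by ring
  calc _ ≤ q ^ (2 * n + 2) * ((1 - q ^ (8 * n + 4)) * (1 - q ^ (8 * n + 4)) * (1 - q ^ (8 * n + 8)) *
        (1 - q ^ (2 * n + 2)) ^ 2) := by
        gcongr ?_ * (?_ * ?_ * ?_ * ?_ ^ 2)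
        · exact pow_le_pow_of_le_one h0.le h1.le (by omega)
        · exact mono (by omega)
        · exact mono (by omega)
        · exact mono (by omega)
        · exact mono (by omega)
    _ = (1 - q ^ (8 * n + 4)) ^ 2 * (1 - q ^ (8 * n + 8)) *
        ((1 - q ^ (2 * n + 2)) ^ 2 * q ^ (2 * n + 2)) := by ring
    _ ≤ (1 - q ^ (8 * n + 4)) ^ 2 * (1 - q ^ (8 * n + 8)) *
        ((1 - q ^ (2 * n + 2)) ^ 2 * (1 / 4 * ((1 + q ^ (2 * n + 2)) ^ 2 *
          (1 + q ^ (4 * n + 4))))) := by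
        gcongr
        have a1 : 4 * q ^ (2 * n + 2) ≤ (1 + q ^ (2 * n + 2)) ^ 2 := by
          nlinarith [sq_nonneg (1 - q ^ (2 * n + 2))]
        have a2 : (1 + q ^ (2 * n + 2)) ^ 2 ≤
            (1 + q ^ (2 * n + 2)) ^ 2 * (1 + q ^ (4 * n + 4)) :=
          le_mul_of_one_le_right (by positivity) (le_add_of_nonneg_right (by positivity))
        linarith
    _ = _ := by rw [e5, e7]; ring

theorem hypD_le {q : ℝ} (h0 : 0 < q) (h1 : q < 1) (n : ℕ) : hypD q n ≤ (1 / 4) ^ n := by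
  induction n with
  | zero => simp [hypD, realPoch]
  | succ n ih =>
    rw [hypD_succ, pow_succ]
    calc _ ≤ hypD q n * (1 / 4) := mul_le_mul_of_nonneg_left (hypD_ratio_le h0 h1 n)
          (hypD_nonneg h0 h1 n)
      _ ≤ _ := mul_le_mul_of_nonneg_right ih (by norm_num)

/-- The coefficients add up to 0, so the polynomial vanishes at q = 1 and can be divided by 1 - q
term by term. -/
theorem numD_eq (q : ℝ) (n : ℕ) :
    numD q n = -(2 * (1 - q ^ (2 * n + 1)) + 3 * (1 - q ^ (4 * n + 2)) + 4 * (1 - q ^ (6 * n + 3))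
    + 3 * (1 - q ^ (8 * n + 4)) - (1 - q ^ (10 * n + 1)) - (1 - q ^ (10 * n + 3))
    + 2 * (1 - q ^ (10 * n + 5)) - 2 * (1 - q ^ (12 * n + 2)) + (1 - q ^ (12 * n + 6))
    - 3 * (1 - q ^ (14 * n + 3)) - 3 * (1 - q ^ (16 * n + 4)) - 3 * (1 - q ^ (18 * n + 5))
    - 2 * (1 - q ^ (20 * n + 6)) - (1 - q ^ (22 * n + 7))) := by
  rw [numD]; ring

/-- Bernoulli gives 0 ≤ 1 - q^e ≤ e(1 - q). The absolute coefficients times the exponents add up to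
346n + 111. -/
theorem abs_numD_le {q : ℝ} (h0 : 0 < q) (h1 : q < 1) (n : ℕ) :
    |numD q n| ≤ 346 * (n + 1) * (1 - q) := by
  have up : ∀ e : ℕ, 1 - q ^ e ≤ e * (1 - q) := fun e => by
    have := one_add_mul_le_pow (a := q - 1) (by linarith) e
    rw [add_sub_cancel] at this
    linarith
  have lo : ∀ e : ℕ, 0 ≤ 1 - q ^ e := fun e => sub_nonneg.2 (pow_le_one₀ h0.le h1.le)
  have u1 := up (2 * n + 1)
  have u2 := up (4 * n + 2)
  have u3 := up (6 * n + 3)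
  have u4 := up (8 * n + 4)
  have u5 := up (10 * n + 1)
  have u6 := up (10 * n + 3)
  have u7 := up (10 * n + 5)
  have u8 := up (12 * n + 2)
  have u9 := up (12 * n + 6)
  have u10 := up (14 * n + 3)
  have u11 := up (16 * n + 4)
  have u12 := up (18 * n + 5)
  have u13 := up (20 * n + 6)
  have u14 := up (22 * n + 7)
  push_cast at u1 u2 u3 u4 u5 u6 u7 u8 u9 u10 u11 u12 u13 u14
  have hn : 0 ≤ (n : ℝ) * (1 - q) := mul_nonneg (by positivity) (by linarith)
  rw [numD_eq, abs_le]
  constructor <;>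
  linarith [lo (2 * n + 1), lo (4 * n + 2), lo (6 * n + 3), lo (8 * n + 4), lo (10 * n + 1),
    lo (10 * n + 3), lo (10 * n + 5), lo (12 * n + 2), lo (12 * n + 6), lo (14 * n + 3),
    lo (16 * n + 4), lo (18 * n + 5), lo (20 * n + 6), lo (22 * n + 7)]

theorem tendsto_numD_div (n : ℕ) :
    Tendsto (fun q : ℝ => numD q n / (1 - q ^ 2)) (𝓝[<] 1) (𝓝 ((154 * n + 15 : ℝ) / 2)) := by
  have l := tendsto_one_sub_pow_div
  have h := (((((((((((((((l (2 * n + 1)).const_mul 2).add ((l (4 * n + 2)).const_mul 3)).add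
    ((l (6 * n + 3)).const_mul 4)).add ((l (8 * n + 4)).const_mul 3)).sub (l (10 * n + 1))).sub
    (l (10 * n + 3))).add ((l (10 * n + 5)).const_mul 2)).sub ((l (12 * n + 2)).const_mul 2)).add
    (l (12 * n + 6))).sub ((l (14 * n + 3)).const_mul 3)).sub ((l (16 * n + 4)).const_mul 3)).sub
    ((l (18 * n + 5)).const_mul 3)).sub ((l (20 * n + 6)).const_mul 2)).sub
    (l (22 * n + 7))).neg.div (l 2) (by norm_num)
  have hv : (154 * n + 15 : ℝ) / 2 = -(2 * ((2 * n + 1 : ℕ) : ℝ) + 3 * (4 * n + 2 : ℕ)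
      + 4 * (6 * n + 3 : ℕ) + 3 * (8 * n + 4 : ℕ) - (10 * n + 1 : ℕ) - (10 * n + 3 : ℕ)
      + 2 * (10 * n + 5 : ℕ) - 2 * (12 * n + 2 : ℕ) + (12 * n + 6 : ℕ) - 3 * (14 * n + 3 : ℕ)
      - 3 * (16 * n + 4 : ℕ) - 3 * (18 * n + 5 : ℕ) - 2 * (20 * n + 6 : ℕ) - (22 * n + 7 : ℕ)) /
      (2 : ℕ) := by
    push_cast
    ring
  rw [hv]
  refine h.congr' ?_
  filter_upwards [eventually_mem_Ioo_zero_one] with q hq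
  have h1 : 1 - q ≠ 0 := by linarith [hq.2]
  rw [numD_eq, ← div_div_div_cancel_right₀ h1 _ (1 - q ^ 2)]
  simp only [Pi.div_apply]
  congr 1
  ring

theorem tendsto_realPoch_odd (m : ℕ) :
    Tendsto (fun q : ℝ => realPoch q (q ^ 2) m / (1 - q) ^ m) (𝓝[<] 1)
      (𝓝 (∏ j ∈ Finset.range m, (2 * j + 1 : ℝ))) := by
  have h := tendsto_finsetProd (Finset.range m) fun j _ => tendsto_one_sub_pow_div (2 * j + 1)
  push_cast at h
  refine h.congr fun q => ?_
  rw [Finset.prod_div_distrib, Finset.prod_const, Finset.card_range, realPoch]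
  congr 1
  exact Finset.prod_congr rfl fun j _ => by ring

theorem tendsto_realPoch_four (m : ℕ) :
    Tendsto (fun q : ℝ => realPoch (q ^ 4) (q ^ 4) m / (1 - q) ^ m) (𝓝[<] 1)
      (𝓝 (∏ j ∈ Finset.range m, (4 * j + 4 : ℝ))) := by
  have h := tendsto_finsetProd (Finset.range m) fun j _ => tendsto_one_sub_pow_div (4 * j + 4)
  push_cast at h
  refine h.congr fun q => ?_
  rw [Finset.prod_div_distrib, Finset.prod_const, Finset.card_range, realPoch]
  congr 1
  exact Finset.prod_congr rfl fun j _ => by ring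

theorem tendsto_hypD (n : ℕ) :
    Tendsto (fun q : ℝ => hypD q n) (𝓝[<] 1)
      (𝓝 (((∏ j ∈ Finset.range (3 * n), (2 * j + 1 : ℝ)) *
        (∏ j ∈ Finset.range n, (2 * j + 1 : ℝ)) ^ 2) /
        ((∏ j ∈ Finset.range n, (4 * j + 4 : ℝ)) *
          (∏ j ∈ Finset.range (2 * n), (4 * j + 4 : ℝ)) ^ 2))) := by
  have hpos : ∀ m : ℕ, (∏ j ∈ Finset.range m, (4 * j + 4 : ℝ)) ≠ 0 := fun m =>
    Finset.prod_ne_zero_iff.2 fun j _ => by positivity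
  have hq : Tendsto (fun q : ℝ => q ^ (7 * n ^ 2)) (𝓝[<] 1) (𝓝 1) := by
    simpa using ((continuous_pow (7 * n ^ 2)).tendsto (1 : ℝ)).mono_left nhdsWithin_le_nhds
  have h := (hq.mul ((tendsto_realPoch_odd (3 * n)).mul ((tendsto_realPoch_odd n).pow 2))).div
    ((tendsto_realPoch_four n).mul ((tendsto_realPoch_four (2 * n)).pow 2))
    (mul_ne_zero (hpos n) (pow_ne_zero 2 (hpos _)))
  rw [one_mul] at h
  refine h.congr' ?_
  filter_upwards [eventually_mem_Ioo_zero_one] with q hq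
  -- Numerator and denominator both contain 5n factors vanishing at q = 1: 3n + 2n and n + 4n.
  have h1 : (1 - q) ^ (5 * n) ≠ 0 := pow_ne_zero _ (by linarith [hq.2])
  rw [hypD, ← div_div_div_cancel_right₀ h1 _ (_ * _ ^ 2)]
  simp only [Pi.div_apply]
  congr 1 <;>
  · rw [show 5 * n = 3 * n + 2 * n by ring]
    ring

theorem rising_succ (x : ℝ) (n : ℕ) : rising x (n + 1) = rising x n * (x + n) := by
  rw [rising, rising, ascPochhammer_succ_eval]

theorem hypergeometric_limit_eq (n : ℕ) :
    (-1) ^ n * (((∏ j ∈ Finset.range (3 * n), (2 * j + 1 : ℝ)) *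
        (∏ j ∈ Finset.range n, (2 * j + 1 : ℝ)) ^ 2) /
        ((∏ j ∈ Finset.range n, (4 * j + 4 : ℝ)) *
          (∏ j ∈ Finset.range (2 * n), (4 * j + 4 : ℝ)) ^ 2)) =
      (-(3 ^ 3 / 2 ^ 9)) ^ n *
        (rising (1 / 2) n * rising (1 / 6) n * rising (5 / 6) n / rising 1 n ^ 3) := by
  induction n with
  | zero => simp [rising]
  | succ n ih =>
    rw [pow_succ (-(3 ^ 3 / 2 ^ 9) : ℝ), rising_succ, rising_succ, rising_succ, rising_succ,
      show 3 * (n + 1) = 3 * n + 1 + 1 + 1 by ring, show 2 * (n + 1) = 2 * n + 1 + 1 by ring]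
    simp only [Finset.prod_range_succ]
    push_cast
    have h0 : (1 + n : ℝ) ≠ 0 := by positivity
    have h2 : (2 * n + 1 : ℝ) ≠ 0 := by positivity
    calc _ = ((-1) ^ n * (((∏ j ∈ Finset.range (3 * n), (2 * j + 1 : ℝ)) *
          (∏ j ∈ Finset.range n, (2 * j + 1 : ℝ)) ^ 2) /
          ((∏ j ∈ Finset.range n, (4 * j + 4 : ℝ)) *
          (∏ j ∈ Finset.range (2 * n), (4 * j + 4 : ℝ)) ^ 2))) *
          (-((2 * (3 * n) + 1) * (2 * (3 * n + 1) + 1) * (2 * (3 * n + 1 + 1) + 1) *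
            (2 * n + 1) ^ 2 / ((4 * n + 4) * ((4 * (2 * n) + 4) * (4 * (2 * n + 1) + 4)) ^ 2))) := by
          generalize (∏ j ∈ Finset.range (3 * n), (2 * j + 1 : ℝ)) = x
          generalize (∏ j ∈ Finset.range n, (2 * j + 1 : ℝ)) = y
          generalize (∏ j ∈ Finset.range n, (4 * j + 4 : ℝ)) = z
          generalize (∏ j ∈ Finset.range (2 * n), (4 * j + 4 : ℝ)) = w
          trans (-1) ^ n * -(x * y ^ 2 / (z * w ^ 2) *
            ((2 * (3 * n) + 1) * (2 * (3 * n + 1) + 1) * (2 * (3 * n + 1 + 1) + 1) *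
            (2 * n + 1) ^ 2 / ((4 * n + 4) * ((4 * (2 * n) + 4) * (4 * (2 * n + 1) + 4)) ^ 2)))
          · rw [pow_succ (-1 : ℝ), div_mul_div_comm, mul_assoc, neg_one_mul]
            congr 3 <;> ring
          · ring
      _ = _ := by
          rw [ih]
          -- The factor (2n+1)² cancels against (8n+4)², leaving the constant 216/4096 = 27/512.
          have e : -((2 * (3 * n) + 1) * (2 * (3 * n + 1) + 1) * (2 * (3 * n + 1 + 1) + 1) *
            (2 * n + 1) ^ 2 / ((4 * n + 4) * ((4 * (2 * n) + 4) * (4 * (2 * n + 1) + 4)) ^ 2)) =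
            -(3 ^ 3 / 2 ^ 9 : ℝ) * ((1 / 2 + n) * (1 / 6 + n) * (5 / 6 + n) / (1 + n) ^ 3) := by
            rw [show (4 * n + 4 : ℝ) = 4 * (1 + n) by ring,
              show (4 * (2 * n) + 4 : ℝ) = 4 * (2 * n + 1) by ring,
              show (4 * (2 * n + 1) + 4 : ℝ) = 8 * (1 + n) by ring]
            field_simp
            ring
          rw [e, mul_pow _ (1 + (n : ℝ)) 3]
          generalize rising 1 n = r
          generalize (1 + n : ℝ) = m at *
          rw [mul_mul_mul_comm, div_mul_div_comm]
          congr 2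
          ring

theorem tendsto_seriesD (n : ℕ) :
    Tendsto (fun q : ℝ => seriesD q n / (1 - (q : ℂ) ^ 2)) (𝓝[<] 1)
      (𝓝 ((seriesE n / 32 : ℝ) : ℂ)) := by
  simp_rw [seriesD_div_eq]
  refine (Complex.continuous_ofReal.tendsto _).comp ?_
  have hc : Tendsto (fun q : ℝ => (q ^ (2 * n + 1) + 1) ^ 2 * (q ^ (4 * n + 2) + 1) ^ 2) (𝓝[<] 1)
      (𝓝 16) := by
    have hc : Continuous fun q : ℝ => (q ^ (2 * n + 1) + 1) ^ 2 * (q ^ (4 * n + 2) + 1) ^ 2 := by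
      fun_prop
    have := (hc.tendsto 1).mono_left (nhdsWithin_le_nhds (s := Set.Iio 1))
    norm_num at this
    exact this
  have h := (((tendsto_hypD n).const_mul ((-1) ^ n)).mul (tendsto_numD_div n)).div hc (by norm_num)
  rw [hypergeometric_limit_eq] at h
  -- The 32 is 2 · 16: 1 - q² ~ 2(1 - q), and the squared factors 1 + q^(2n+1) and 1 + q^(4n+2)
  -- contribute 2² · 2².
  have e : seriesE n / 32 = (-(3 ^ 3 / 2 ^ 9)) ^ n *
      (rising (1 / 2) n * rising (1 / 6) n * rising (5 / 6) n / rising 1 n ^ 3) *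
        ((154 * n + 15) / 2) / 16 := by
    rw [seriesE]
    ring
  rw [e]
  exact h

/-- The linear growth n + 1 ≤ 2^n is absorbed by the decay (1/4)^n, and 1 - q ≤ 1 - q² removes the
singular quotient. This is the dominating sequence. -/
theorem norm_seriesD_div_le {q : ℝ} (h0 : 0 < q) (h1 : q < 1) (n : ℕ) :
    ‖seriesD q n / (1 - (q : ℂ) ^ 2)‖ ≤ 346 * (1 / 2) ^ n := by
  have hd : 1 - q ≤ 1 - q ^ 2 := by nlinarith
  have hd0 : 0 < 1 - q ^ 2 := by linarith
  have hn : |numD q n / (1 - q ^ 2)| ≤ 346 * 2 ^ n := by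
    rw [abs_div, abs_of_pos hd0, div_le_iff₀ hd0]
    have h2 : (n + 1 : ℝ) ≤ 2 ^ n := by exact_mod_cast Nat.lt_two_pow_self (n := n)
    calc _ ≤ 346 * (n + 1) * (1 - q) := abs_numD_le h0 h1 n
      _ ≤ 346 * 2 ^ n * (1 - q ^ 2) := by
        have : 0 ≤ 1 - q := by linarith
        gcongr
  have hden : 1 ≤ (q ^ (2 * n + 1) + 1) ^ 2 * (q ^ (4 * n + 2) + 1) ^ 2 :=
    one_le_mul_of_one_le_of_one_le
      (one_le_pow₀ (le_add_of_nonneg_left (by positivity)))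
      (one_le_pow₀ (le_add_of_nonneg_left (by positivity)))
  rw [seriesD_div_eq, Complex.norm_real, Real.norm_eq_abs, abs_div,
    abs_of_pos (zero_lt_one.trans_le hden)]
  refine (div_le_self (abs_nonneg _) hden).trans ?_
  rw [abs_mul, abs_mul, abs_pow, abs_neg, abs_one, one_pow, one_mul,
    abs_of_nonneg (hypD_nonneg h0 h1 n)]
  calc _ ≤ (1 / 4) ^ n * (346 * 2 ^ n) :=
        mul_le_mul (hypD_le h0 h1 n) hn (abs_nonneg _) (by positivity)
    _ = 346 * (1 / 2) ^ n := by
        rw [mul_left_comm, ← mul_pow]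
        norm_num

theorem hasSum_seriesE : HasSum seriesE (32 * Real.sqrt 2 / Real.pi) := by
  have hgeo : Summable fun n : ℕ => (346 : ℝ) * (1 / 2) ^ n :=
    summable_geometric_two.mul_left 346
  have hbound : ∀ᶠ q : ℝ in 𝓝[<] 1, ∀ n, ‖seriesD q n / (1 - (q : ℂ) ^ 2)‖ ≤ 346 * (1 / 2) ^ n := by
    filter_upwards [eventually_mem_Ioo_zero_one] with q hq n
    exact norm_seriesD_div_le hq.1 hq.2 n
  have hlim := tendsto_tsum_of_dominated_convergence hgeo tendsto_seriesD hbound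
  have hval : ∑' n, ((seriesE n / 32 : ℝ) : ℂ) = ((Real.sqrt 2 / Real.pi : ℝ) : ℂ) := by
    refine tendsto_nhds_unique hlim (tendsto_valueD.congr' ?_)
    filter_upwards [eventually_mem_Ioo_zero_one] with q hq
    exact ((one_variable_identity hq.1 hq.2).div_const _).tsum_eq.symm
  have hs : Summable fun n => ((seriesE n / 32 : ℝ) : ℂ) :=
    Summable.of_norm_bounded hgeo fun n =>
      le_of_tendsto (tendsto_seriesD n).norm (hbound.mono fun q h => h n)
  have h := hs.hasSum
  rw [hval, Complex.hasSum_ofReal] at h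
  have h2 := h.mul_left 32
  have e : (fun n => 32 * (seriesE n / 32)) = seriesE := funext fun n => by ring
  rwa [e, ← mul_div_assoc] at h2

end SeriesD

theorem mainTheorem2 :
    (∀ (q : ℝ), 0 < q → q < 1 → ∀ (b c : ℂ),
      (∀ m : ℕ, (q : ℂ) ^ (2 * b + 2 + 2 * m) ≠ 1) →
      (∀ m : ℕ, (q : ℂ) ^ (2 * c + 2 + 2 * m) ≠ 1) →
      (∀ a : ℂ, 0 < a.re →
        Summable (seriesA q a b c) ∧ Summable (seriesB q a b c) ∧
          (1 - (q : ℂ) ^ (2 * a)) * ∑' k, seriesA q a b c k = -∑' n, seriesB q a b c n) ∧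
      HasSum (seriesC q b c) (valueC q b c)) ∧
    (∀ (q : ℝ), 0 < q → q < 1 →
      (∀ n, seriesC (q ^ 2) 0 0 n = seriesD q n) ∧ valueC (q ^ 2) 0 0 = valueD q ∧
      HasSum (seriesD q) (valueD q)) ∧
    (∀ n, Tendsto (fun q : ℝ => seriesD q n / (1 - (q : ℂ) ^ 2)) (𝓝[<] 1)
      (𝓝 ((seriesE n / 32 : ℝ) : ℂ))) ∧
    Tendsto (fun q : ℝ => valueD q / (1 - (q : ℂ) ^ 2)) (𝓝[<] 1)
      (𝓝 ((Real.sqrt 2 / Real.pi : ℝ) : ℂ)) ∧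
    HasSum seriesE (32 * Real.sqrt 2 / Real.pi) :=
  ⟨fun _ hq hq1 _ _ hb hc => ⟨fun _ ha => three_parameter_identity hq hq1 hb hc ha,
      two_parameter_identity hq hq1 hb hc⟩,
    fun _ hq hq1 => ⟨seriesC_sq_zero hq hq1, valueC_sq_zero hq hq1, one_variable_identity hq hq1⟩,
    tendsto_seriesD, tendsto_valueD, hasSum_seriesE⟩
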